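/- An effect algebra is a set $E$ with constants $0,1$ and a partial operation $\oplus$ (write $a\perp b$ if $a\oplus b$ is defined) such that: $\oplus$ is commutative and associative (if $a\perp b$ and $a\oplus b\perp c$, then $b\perp c$, $a\perp b\oplus c$ and $(a\oplus b)\oplus c=a\oplus(b\oplus c)$); for each $a$ there is a unique $a^\perp$ with $a\oplus a^\perp=1$; and $a\perp 1$ implies $a=0$. It is ordered by $a\le b$ iff $a\oplus c=b$ for some $c$. It is monotone $\sigma$-complete if every ascending sequence has a supremum. It is a sequential effect algebra (SEA) if it carries a binary operation $\circ$ such that, writing $a|b$ for $a\circ b=b\circ a$: $a\circ(b\oplus c)=a\circ b\oplus a\circ c$; $1\circ a=a$; $a\circ b=0$ implies $b\circ a=0$; $a|b$ implies $a|b^\perp$ and $a\circ(b\circ c)=(a\circ b)\circ c$ for all $c$; and $c|a$, $c|b$ imply $c|(a\circ b)$ and, if $a\perp b$, $c|(a\oplus b)$. It is commutative if $a|b$ for all $a,b$. It is convex if it carries a multiplication by scalars $\lambda\in[0,1]$ with $\mu(\lambda a)=(\lambda\mu)a$; $(\lambda+\mu)a=\lambda a\oplus\mu a$ if $\lambda+\mu\le1$;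 $\lambda(a\oplus b)=\lambda a\oplus\lambda b$ if $a\perp b$; and $1a=a$. A convex effect algebra is strongly archimedean if $a\le b\oplus\frac1n c$ for all $n\ge1$ implies $a\le b$. Such an $E$ is the unit interval $[0,u]$ of an order unit space $(V,V^+,u)$; it is norm-complete if it is complete in the norm $\|v\|=\inf\{\lambda>0:-\lambda u\le v\le\lambda u\}$ of $V$. Let $P$ be the set of sharp elements of a SEA $E$ ($p\in P$ iff $x\le p$, $x\le p^\perp$ imply $x=0$) and $J_p(a)=p\circ a$ for $p\in P$; $(J_p)_{p\in P}$ is a compression base of $E$. For $p\in P$ put $C(p)=\{a: a=J_p(a)\oplus J_{p^\perp}(a)\}$; for $Q\subseteq E$ put $PC(Q)=\{p\in P: Q\subseteq C(p)\}$ and $P(Q)=PC(PC(Q)\cup Q)$. Elements $p,q$ are compatible if $p=p_1\oplus c$, $q=q_1\oplus c$ for some $p_1,q_1,c$ such that $p_1\oplus q_1\oplus c$ exists. We write $eCf$ if all $p\in P(\{e\})$, $q\in P(\{f\})$ are compatible. $E$ is spectral if - for each $a\in E$ there is $a^\circ\in P$ such that for all $q\in P$: $a\le q$ iff $a^\circ\le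 q$; - for each $a\in E$ there is a Boolean subalgebra $B\subseteq P$ such that for all $p\in P$: $a\in C(p)$ iff $B\subseteq C(p)$; - whenever $eCf$, there is $p\in P(\{e,f\})$ with $J_p(e)\le J_p(f)$ and $J_{p^\perp}(f)\le J_{p^\perp}(e)$. For a compact Hausdorff space $X$, the set $C(X,[0,1])$ of continuous functions $X\to[0,1]$ is a convex SEA with the pointwise partial sum ($f\perp g$ iff $f+g\le1$), product and scalar multiples. $X$ is basically disconnected if the closure of every cozero set $\{f\ne0\}$, $f\in C(X,\mathbb R)$, is open. Isomorphisms and subalgebras below are those of convex sequential effect algebras. **Theorem.** Let $E$ be a commutative SEA which is also convex and strongly archimedean. Then $E$ is isomorphic to a (uniformly) dense subalgebra of $C(X,[0,1])$ for some compact Hausdorff space $X$. Moreover, the following are equivalent: 1. $E$ is monotone $\sigma$-complete; 2. $E\simeq C(X,[0,1])$ for some basically disconnected compact Hausdorff space $X$; 3. $E$ is norm-complete and spectral. -/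

import Mathlib

open Set
open scoped unitInterval

universe u v

/-! ### Effect algebras -/

/-- An effect algebra. The partial operation is given by its domain `Perp` together with a function
`oplus`, whose values matter (and are used) only on pairs with `Perp a b`. -/
class EffectAlgebra (E : Type u) extends Zero E, One E where
  Perp : E → E → Prop
  oplus : E → E → E
  orth : E → E
  comm : ∀ a b, Perp a b → Perp b a ∧ oplus a b = oplus b a
  assoc : ∀ a b c, Perp a b → Perp (oplus a b) c →
    Perp b c ∧ Perp a (oplus b c) ∧ oplus (oplus a b) c = oplus a (oplus b c)
  perp_orth : ∀ a, Perp a (orth a)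
  oplus_orth : ∀ a, oplus a (orth a) = 1
  orth_unique : ∀ a b, Perp a b → oplus a b = 1 → b = orth a
  eq_zero_of_perp_one : ∀ a, Perp a 1 → a = 0

infix:50 " ⟂ₑ " => EffectAlgebra.Perp
infixl:65 " ⊕ₑ " => EffectAlgebra.oplus
postfix:max "ᗮₑ" => EffectAlgebra.orth

namespace EffectAlgebra

section Basic
variable {E : Type u} [EffectAlgebra E]

/-- The order of an effect algebra. -/
def Le (a b : E) : Prop := ∃ c, a ⟂ₑ c ∧ a ⊕ₑ c = b

infix:50 " ≼ " => EffectAlgebra.Le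

/-- `a ∧ aᗮ = 0`. -/
def IsSharp (a : E) : Prop := ∀ x : E, x ≼ a → x ≼ aᗮₑ → x = 0

/-- Mackey compatibility. -/
def Compatible (a b : E) : Prop :=
  ∃ a₁ b₁ c : E, a₁ ⟂ₑ b₁ ∧ (a₁ ⊕ₑ b₁) ⟂ₑ c ∧ a = a₁ ⊕ₑ c ∧ b = b₁ ⊕ₑ c

/-- Sub-effect algebras. -/
structure IsSubEA (S : Set E) : Prop where
  zero_mem : (0 : E) ∈ S
  one_mem : (1 : E) ∈ S
  orth_mem : ∀ a ∈ S, aᗮₑ ∈ S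
  oplus_mem : ∀ a ∈ S, ∀ b ∈ S, a ⟂ₑ b → a ⊕ₑ b ∈ S

/-- Every ascending sequence has a supremum. -/
def MonotoneSigmaComplete (E : Type u) [EffectAlgebra E] : Prop :=
  ∀ f : ℕ → E, (∀ n, f n ≼ f (n + 1)) →
    ∃ s : E, (∀ n, f n ≼ s) ∧ ∀ t : E, (∀ n, f n ≼ t) → s ≼ t

/-! Elementary facts about effect algebras. -/

theorem orth_orth (a : E) : aᗮₑᗮₑ = a := by
  have h := comm a aᗮₑ (perp_orth a)
  exact (orth_unique _ _ h.1 (by rw [← h.2, oplus_orth])).symm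

theorem orth_one : (1 : E)ᗮₑ = 0 :=
  eq_zero_of_perp_one _ (comm _ _ (perp_orth (1 : E))).1

theorem orth_zero : (0 : E)ᗮₑ = 1 := by rw [← orth_one, orth_orth]

theorem perp_zero (a : E) : a ⟂ₑ 0 ∧ a ⊕ₑ 0 = a := by
  have h1 := comm a aᗮₑ (perp_orth a)
  have h2 : (aᗮₑ ⊕ₑ a) ⟂ₑ 0 := by
    rw [← h1.2, oplus_orth, ← orth_one]; exact perp_orth 1
  have h3 := assoc aᗮₑ a 0 h1.1 h2
  refine ⟨h3.1, ?_⟩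
  have h4 : aᗮₑ ⊕ₑ (a ⊕ₑ 0) = 1 := by
    rw [← h3.2.2, ← h1.2, oplus_orth, ← orth_one, oplus_orth]
  rw [orth_unique _ _ h3.2.1 h4, orth_orth]

theorem zero_perp (a : E) : 0 ⟂ₑ a ∧ 0 ⊕ₑ a = a := by
  have h := comm a 0 (perp_zero a).1
  exact ⟨h.1, by rw [← h.2, (perp_zero a).2]⟩

theorem cancel {a b c : E} (hb : a ⟂ₑ b) (hc : a ⟂ₑ c) (h : a ⊕ₑ b = a ⊕ₑ c) : b = c := by
  have key : ∀ d : E, a ⟂ₑ d → d = (a ⊕ₑ (a ⊕ₑ d)ᗮₑ)ᗮₑ := by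
    intro d hd
    have h0 := comm a d hd
    have h1 : (d ⊕ₑ a) ⟂ₑ (a ⊕ₑ d)ᗮₑ := by rw [← h0.2]; exact perp_orth _
    have h2 := assoc d a _ h0.1 h1
    have h3 := comm _ _ h2.2.1
    apply orth_unique _ _ h3.1
    rw [← h3.2, ← h2.2.2, ← h0.2, oplus_orth]
  rw [key b hb, key c hc, h]

theorem eq_zero_of_oplus_eq_zero {a b : E} (h : a ⟂ₑ b) (h0 : a ⊕ₑ b = 0) : a = 0 := by
  have h1 := comm a b h
  have h2 : (b ⊕ₑ a) ⟂ₑ 1 := by rw [← h1.2, h0]; exact (zero_perp 1).1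
  exact eq_zero_of_perp_one _ (assoc _ _ _ h1.1 h2).1

theorem zero_le (a : E) : 0 ≼ a := ⟨a, zero_perp a⟩

theorem le_one (a : E) : a ≼ 1 := ⟨aᗮₑ, perp_orth a, oplus_orth a⟩

theorem le_refl (a : E) : a ≼ a := ⟨0, perp_zero a⟩

theorem le_trans {a b c : E} (h : a ≼ b) (h' : b ≼ c) : a ≼ c := by
  obtain ⟨d, hd, rfl⟩ := h
  obtain ⟨e, he, rfl⟩ := h'
  have := assoc _ _ _ hd he
  exact ⟨d ⊕ₑ e, this.2.1, this.2.2.symm⟩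

theorem le_antisymm {a b : E} (h : a ≼ b) (h' : b ≼ a) : a = b := by
  obtain ⟨d, hd, rfl⟩ := h
  obtain ⟨e, he, h2⟩ := h'
  have h3 := assoc _ _ _ hd he
  have h4 := cancel h3.2.1 (perp_zero a).1 (by rw [← h3.2.2, h2, (perp_zero a).2])
  rw [eq_zero_of_oplus_eq_zero h3.1 h4, (perp_zero a).2]

theorem le_zero {a : E} (h : a ≼ 0) : a = 0 := le_antisymm h (zero_le a)

theorem perp_iff {a b : E} : a ⟂ₑ b ↔ a ≼ bᗮₑ := by
  constructor
  · intro h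
    have h0 := comm a b h
    have h1 : (b ⊕ₑ a) ⟂ₑ (a ⊕ₑ b)ᗮₑ := by rw [← h0.2]; exact perp_orth _
    have h2 := assoc _ _ _ h0.1 h1
    refine ⟨_, h2.1, orth_unique _ _ h2.2.1 ?_⟩
    rw [← h2.2.2, ← h0.2, oplus_orth]
  · rintro ⟨c, hc, h⟩
    have h0 := comm a c hc
    have h1 : (c ⊕ₑ a) ⟂ₑ b := by
      rw [← h0.2, h]; exact (comm _ _ (perp_orth b)).1
    exact (assoc _ _ _ h0.1 h1).1

theorem le_orth_comm {a b : E} (h : a ≼ bᗮₑ) : b ≼ aᗮₑ :=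
  perp_iff.1 (comm _ _ (perp_iff.2 h)).1

theorem le_oplus_left {a b : E} (h : a ⟂ₑ b) : a ≼ a ⊕ₑ b := ⟨b, h, rfl⟩

theorem le_oplus_right {a b : E} (h : a ⟂ₑ b) : b ≼ a ⊕ₑ b :=
  ⟨a, (comm _ _ h).1, (comm _ _ h).2.symm⟩

theorem orth_le_orth {a b : E} (h : a ≼ b) : bᗮₑ ≼ aᗮₑ :=
  le_orth_comm (by rwa [orth_orth])

theorem IsSharp.orth {p : E} (hp : IsSharp p) : IsSharp pᗮₑ := by
  intro x h1 h2
  rw [orth_orth] at h2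
  exact hp x h2 h1

end Basic

/-! ### Compression bases and spectrality -/

section Compression
variable {E : Type u} [EffectAlgebra E]

/-- Additive maps. -/
def IsAdditive {F : Type v} [EffectAlgebra F] (J : E → F) : Prop :=
  ∀ a b, a ⟂ₑ b → J a ⟂ₑ J b ∧ J (a ⊕ₑ b) = J a ⊕ₑ J b

/-- A compression: a retraction `J` (with focus `J 1`) whose kernel is the interval below the
orthosupplement of the focus. -/
structure IsCompression (J : E → E) : Prop where
  additive : IsAdditive J
  retract : ∀ a, a ≼ J 1 → J a = a
  ker : ∀ a, J a = 0 ↔ a ≼ (J 1)ᗮₑ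

variable (E) in
/-- A compression base `(J p)` indexed by the `p ∈ P`; the maps `J p` for `p ∉ P` are irrelevant. -/
structure CompressionBase where
  P : Set E
  J : E → E → E
  isSubEA : IsSubEA P
  isCompression : ∀ p ∈ P, IsCompression (J p)
  focus : ∀ p ∈ P, J p 1 = p
  normal : ∀ e f d : E, e ⟂ₑ f → (e ⊕ₑ f) ⟂ₑ d → e ⊕ₑ d ∈ P → f ⊕ₑ d ∈ P → d ∈ P
  comp : ∀ p ∈ P, ∀ q ∈ P, ∀ r ∈ P, p ⟂ₑ q → (p ⊕ₑ q) ⟂ₑ r →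
    ∀ a, J (p ⊕ₑ q) (J (q ⊕ₑ r) a) = J q a

/-- `m` is the meet of `x` and `y` in the poset `B`. -/
def IsMeetIn (B : Set E) (x y m : E) : Prop :=
  m ∈ B ∧ m ≼ x ∧ m ≼ y ∧ ∀ z ∈ B, z ≼ x → z ≼ y → z ≼ m

/-- `j` is the join of `x` and `y` in the poset `B`. -/
def IsJoinIn (B : Set E) (x y j : E) : Prop :=
  j ∈ B ∧ x ≼ j ∧ y ≼ j ∧ ∀ z ∈ B, x ≼ z → y ≼ z → j ≼ z

/-- `B` is a sub-effect algebra of `E` contained in `P` which, with the induced order and with `ᗮₑ`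
as complementation, is a Boolean algebra. -/
structure IsBooleanSubalgebra (P B : Set E) : Prop where
  subset : B ⊆ P
  isSubEA : IsSubEA B
  exists_meet : ∀ x ∈ B, ∀ y ∈ B, ∃ m, IsMeetIn B x y m
  exists_join : ∀ x ∈ B, ∀ y ∈ B, ∃ j, IsJoinIn B x y j
  meet_orth : ∀ x ∈ B, IsMeetIn B x xᗮₑ 0
  join_orth : ∀ x ∈ B, IsJoinIn B x xᗮₑ 1
  distrib : ∀ x ∈ B, ∀ y ∈ B, ∀ z ∈ B, ∀ j m m₁ m₂ : E,
    IsJoinIn B y z j → IsMeetIn B x j m → IsMeetIn B x y m₁ → IsMeetIn B x z m₂ →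
      IsJoinIn B m₁ m₂ m

namespace CompressionBase
variable (𝒥 : CompressionBase E)

/-- The commutant `C(p)` of a projection. -/
def C (p : E) : Set E := {a | 𝒥.J p a ⟂ₑ 𝒥.J pᗮₑ a ∧ a = 𝒥.J p a ⊕ₑ 𝒥.J pᗮₑ a}

/-- `PC(A)`: the projections commuting with every element of `A`. -/
def PC (A : Set E) : Set E := {p | p ∈ 𝒥.P ∧ ∀ a ∈ A, a ∈ 𝒥.C p}

/-- The `P`-bicommutant `P(Q) = PC(PC(Q) ∪ Q)`. -/
def biComm (Q : Set E) : Set E := 𝒥.PC (𝒥.PC Q ∪ Q)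

def IsProjectionCover (a p : E) : Prop :=
  p ∈ 𝒥.P ∧ ∀ q ∈ 𝒥.P, a ≼ q ↔ p ≼ q

def ProjectionCoverProperty : Prop := ∀ a : E, ∃ p, 𝒥.IsProjectionCover a p

def IsBElement (a : E) : Prop :=
  ∃ B : Set E, IsBooleanSubalgebra 𝒥.P B ∧
    ∀ p ∈ 𝒥.P, a ∈ 𝒥.C p ↔ ∀ b ∈ B, b ∈ 𝒥.C p

def BProperty : Prop := ∀ a : E, 𝒥.IsBElement a

/-- The relation `e C f`: the bicommutants of `e` and `f` are elementwise compatible. -/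
def Commute (e f : E) : Prop :=
  ∀ p ∈ 𝒥.biComm {e}, ∀ q ∈ 𝒥.biComm {f}, Compatible p q

def BComparability : Prop :=
  𝒥.BProperty ∧ ∀ e f : E, 𝒥.Commute e f →
    ∃ p ∈ 𝒥.biComm {e, f}, 𝒥.J p e ≼ 𝒥.J p f ∧ 𝒥.J pᗮₑ f ≼ 𝒥.J pᗮₑ e

def Spectral : Prop := 𝒥.ProjectionCoverProperty ∧ 𝒥.BComparability

end CompressionBase
end Compression

/-! ### Sequential effect algebras -/

/-- A sequential product on an effect algebra. -/
class SequentialProduct (E : Type u) [EffectAlgebra E] where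
  seq : E → E → E
  seq_oplus : ∀ a b c, b ⟂ₑ c → seq a b ⟂ₑ seq a c ∧ seq a (b ⊕ₑ c) = seq a b ⊕ₑ seq a c
  one_seq : ∀ a, seq 1 a = a
  seq_eq_zero : ∀ a b, seq a b = 0 → seq b a = 0
  comm_orth : ∀ a b, seq a b = seq b a → seq a bᗮₑ = seq bᗮₑ a
  seq_assoc : ∀ a b, seq a b = seq b a → ∀ c, seq a (seq b c) = seq (seq a b) c
  comm_seq : ∀ a b c, seq c a = seq a c → seq c b = seq b c → seq c (seq a b) = seq (seq a b) c
  comm_oplus : ∀ a b c, seq c a = seq a c → seq c b = seq b c → a ⟂ₑ b →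
    seq c (a ⊕ₑ b) = seq (a ⊕ₑ b) c

infixl:70 " ∘ₑ " => SequentialProduct.seq

section SEA
open SequentialProduct
variable {E : Type u} [EffectAlgebra E] [SequentialProduct E]

theorem seq_zero (a : E) : a ∘ₑ 0 = 0 := by
  have h := seq_oplus a 0 0 (perp_zero 0).1
  rw [(perp_zero (0 : E)).2] at h
  exact cancel h.1 (perp_zero _).1 (by rw [← h.2, (perp_zero _).2])

theorem zero_seq (a : E) : 0 ∘ₑ a = 0 := seq_eq_zero _ _ (seq_zero a)

theorem seq_one (a : E) : a ∘ₑ 1 = a := by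
  have := comm_orth a 0 (by rw [seq_zero, zero_seq])
  rw [orth_zero, one_seq] at this
  exact this

theorem seq_mono (a : E) {b c : E} (h : b ≼ c) : a ∘ₑ b ≼ a ∘ₑ c := by
  obtain ⟨d, hd, rfl⟩ := h
  exact ⟨a ∘ₑ d, (seq_oplus a b d hd).1, (seq_oplus a b d hd).2.symm⟩

theorem seq_le (a b : E) : a ∘ₑ b ≼ a := by
  have := seq_mono a (le_one b)
  rwa [seq_one] at this

theorem seq_orth_of_sharp {p : E} (hp : IsSharp p) : p ∘ₑ pᗮₑ = 0 := by
  refine hp _ (seq_le _ _) ?_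
  rw [comm_orth p p rfl]
  exact seq_le _ _

theorem seq_eq_self {p a : E} (hp : IsSharp p) (h : a ≼ p) : p ∘ₑ a = a ∧ a ∘ₑ p = a := by
  have h1 : pᗮₑ ∘ₑ a = 0 := by
    have := seq_mono pᗮₑ h
    rw [seq_eq_zero _ _ (seq_orth_of_sharp hp)] at this
    exact le_zero this
  have h2 := seq_eq_zero _ _ h1
  have h3 := comm_orth a pᗮₑ (by rw [h1, h2])
  rw [orth_orth] at h3
  have h4 := seq_oplus a p pᗮₑ (perp_orth p)
  rw [oplus_orth, seq_one, h2, (perp_zero _).2] at h4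
  exact ⟨by rw [← h3, ← h4.2], h4.2.symm⟩

theorem seq_eq_zero_iff {p a : E} (hp : IsSharp p) : p ∘ₑ a = 0 ↔ a ≼ pᗮₑ := by
  constructor
  · intro h
    have h2 := seq_eq_zero _ _ h
    have h3 := comm_orth a p (by rw [h, h2])
    have h4 := seq_oplus a p pᗮₑ (perp_orth p)
    rw [oplus_orth, seq_one, h2, (zero_perp _).2] at h4
    rw [h4.2, h3]
    exact seq_le _ _
  · intro h
    have := seq_mono p h
    rw [seq_orth_of_sharp hp] at this
    exact le_zero this

theorem isSharp_of_idem {d : E} (h : d ∘ₑ d = d) : IsSharp d := by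
  have h0 : d ∘ₑ dᗮₑ = 0 := by
    have h4 := seq_oplus d d dᗮₑ (perp_orth d)
    rw [oplus_orth, seq_one, h] at h4
    exact cancel h4.1 (perp_zero d).1 (by rw [← h4.2, (perp_zero d).2])
  intro x hx hx'
  have h1 : d ∘ₑ x = 0 := le_zero (by have := seq_mono d hx'; rwa [h0] at this)
  have h2 : dᗮₑ ∘ₑ x = 0 :=
    le_zero (by have := seq_mono dᗮₑ hx; rwa [seq_eq_zero _ _ h0] at this)
  have h4 := seq_oplus x d dᗮₑ (perp_orth d)
  rw [oplus_orth, seq_one, seq_eq_zero _ _ h1, seq_eq_zero _ _ h2, (perp_zero _).2] at h4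
  exact h4.2

theorem IsSharp.oplus {p q : E} (hp : IsSharp p) (hq : IsSharp q) (h : p ⟂ₑ q) :
    IsSharp (p ⊕ₑ q) := by
  intro x hx hx'
  have hxp : x ≼ pᗮₑ := le_trans hx' (orth_le_orth (le_oplus_left h))
  have hxq : x ≼ qᗮₑ := le_trans hx' (orth_le_orth (le_oplus_right h))
  refine hq x ?_ hxq
  have h1 := seq_mono pᗮₑ hx
  rw [(seq_eq_self hp.orth hxp).1, (seq_oplus _ _ _ h).2, seq_eq_zero _ _ (seq_orth_of_sharp hp),
    (zero_perp _).2, (seq_eq_self hp.orth (perp_iff.1 (comm _ _ h).1)).1] at h1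
  exact h1

/-- If `e ⊕ d` and `f ⊕ d` are sharp and `e ⊕ f ⊕ d` exists, then their product is `d`. -/
theorem seq_oplus_oplus {e f d : E} (h : e ⟂ₑ f) (h' : (e ⊕ₑ f) ⟂ₑ d)
    (hp : IsSharp (e ⊕ₑ d)) : (e ⊕ₑ d) ∘ₑ (f ⊕ₑ d) = d := by
  have h1 := assoc e f d h h'
  have h2 := comm f d h1.1
  have h3 : e ⟂ₑ (d ⊕ₑ f) := by rw [← h2.2]; exact h1.2.1
  have h4 := comm _ _ h3
  have h5 := assoc d f e h2.1 h4.1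
  have h6 := comm f e h5.1
  have hef : (f ⊕ₑ e) ⟂ₑ d := (comm _ _ h5.2.1).1
  have h8 := assoc f e d h5.1 hef
  have hf : f ≼ (e ⊕ₑ d)ᗮₑ := perp_iff.1 h8.2.1
  have hd : d ≼ e ⊕ₑ d := le_oplus_right h8.1
  rw [(seq_oplus _ _ _ h1.1).2, (seq_eq_zero_iff hp).2 hf, (zero_perp _).2, (seq_eq_self hp hd).1]

theorem isSharp_of_normal {e f d : E} (h : e ⟂ₑ f) (h' : (e ⊕ₑ f) ⟂ₑ d)
    (hp : IsSharp (e ⊕ₑ d)) (hq : IsSharp (f ⊕ₑ d)) : IsSharp d := by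
  have h0 := comm e f h
  have h1 := assoc e f d h h'
  have h0' : (f ⊕ₑ e) ⟂ₑ d := by rwa [← h0.2]
  have h2 := assoc f e d h0.1 h0'
  have e1 := seq_oplus_oplus h h' hp
  have e2 := seq_oplus_oplus h0.1 h0' hq
  apply isSharp_of_idem
  have := seq_assoc (e ⊕ₑ d) (f ⊕ₑ d) (by rw [e1, e2]) d
  rw [e1, (seq_eq_self hq (le_oplus_right h1.1)).1,
    (seq_eq_self hp (le_oplus_right h2.1)).1] at this
  exact this.symm

variable (E) in
/-- The compression base of a sequential effect algebra: `P` is the set of all sharp elements and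
`J p a = p ∘ a`. -/
def seqBase : CompressionBase E where
  P := {p | IsSharp p}
  J p a := p ∘ₑ a
  isSubEA :=
    { zero_mem := fun _ h _ => le_zero h
      one_mem := fun x _ h => by rw [orth_one] at h; exact le_zero h
      orth_mem := fun _ h => IsSharp.orth h
      oplus_mem := fun _ ha _ hb h => IsSharp.oplus ha hb h }
  isCompression := fun p hp =>
    { additive := fun a b h => seq_oplus p a b h
      retract := fun a h => by
        simp only [seq_one] at h
        exact (seq_eq_self hp h).1
      ker := fun a => by
        simp only [seq_one]
        exact seq_eq_zero_iff hp }
  focus := fun p _ => seq_one p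
  normal := fun _ _ _ h h' hp hq => isSharp_of_normal h h' hp hq
  comp := fun p hp q hq r hr h h' a => by
    have h1 := assoc p q r h h'
    have h2 := comm q r h1.1
    have hp' : IsSharp (p ⊕ₑ q) := IsSharp.oplus hp hq h
    have hr' : IsSharp (r ⊕ₑ q) := IsSharp.oplus hr hq h2.1
    have h3 : p ⟂ₑ (r ⊕ₑ q) := by rw [← h2.2]; exact h1.2.1
    have h4 := comm _ _ h3
    have h10 : (r ⊕ₑ p) ⟂ₑ q := by
      have h11 := comm q r h1.1
      have h12 : (q ⊕ₑ r) ⟂ₑ p := by rw [h11.2]; exact h4.1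
      have h13 := assoc q r p h1.1 h12
      exact (comm _ _ h13.2.1).1
    have h14 : r ⟂ₑ p := by
      have h12 : (q ⊕ₑ r) ⟂ₑ p := by rw [h2.2]; exact h4.1
      exact (assoc q r p h1.1 h12).1
    have h15 := comm _ _ h14
    have h16 : (p ⊕ₑ r) ⟂ₑ q := by rw [← h15.2]; exact h10
    have e1 := seq_oplus_oplus h15.1 h16 hp'
    have e2 := seq_oplus_oplus h14 h10 hr'
    show (p ⊕ₑ q) ∘ₑ ((q ⊕ₑ r) ∘ₑ a) = q ∘ₑ a
    rw [h2.2, seq_assoc _ _ (by rw [e1, e2]), e1]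

end SEA

/-! ### Convex effect algebras -/

/-- A convex structure on an effect algebra. -/
class ConvexStructure (E : Type u) [EffectAlgebra E] where
  scal : I → E → E
  scal_scal : ∀ (l m : I) (a : E), scal m (scal l a) = scal (l * m) a
  add_scal : ∀ (l m n : I) (a : E), (l : ℝ) + m = n →
    scal l a ⟂ₑ scal m a ∧ scal n a = scal l a ⊕ₑ scal m a
  scal_oplus : ∀ (l : I) (a b : E), a ⟂ₑ b →
    scal l a ⟂ₑ scal l b ∧ scal l (a ⊕ₑ b) = scal l a ⊕ₑ scal l b
  one_scal : ∀ a : E, scal 1 a = a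

infixr:73 " •ₑ " => ConvexStructure.scal

/-- The number `1 / (n + 1)` in `[0, 1]`. -/
noncomputable def invSucc (n : ℕ) : I :=
  ⟨1 / ((n : ℝ) + 1), by positivity, by
    rw [div_le_one (by positivity)]; linarith [(Nat.cast_nonneg n : (0 : ℝ) ≤ n)]⟩

/-- If `b ⊕ (1/n) c` exists and `a ≤ b ⊕ (1/n) c` for all `n = 1, 2, …`, then `a ≤ b`. -/
def StronglyArchimedean (E : Type u) [EffectAlgebra E] [ConvexStructure E] : Prop :=
  ∀ a b c : E, (∀ n : ℕ, b ⟂ₑ invSucc n •ₑ c ∧ a ≼ b ⊕ₑ invSucc n •ₑ c) → a ≼ b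

section Norm
variable {E : Type u} [EffectAlgebra E] [ConvexStructure E]

/-- The inequality `a ≤ b + l u` of the ordered vector space whose unit interval `[0, u]` is `E`.
It is halved so that both sides lie in `E`: `½ a ≤ ½ b ⊕ ½ l 1`. -/
def LeAdd (l : I) (a b : E) : Prop :=
  invSucc 1 •ₑ b ⟂ₑ invSucc 1 •ₑ l •ₑ (1 : E) ∧
    invSucc 1 •ₑ a ≼ invSucc 1 •ₑ b ⊕ₑ invSucc 1 •ₑ l •ₑ (1 : E)

/-- The distance `‖a - b‖` in the order unit norm
`‖v‖ = inf {l > 0 : -l u ≤ v ≤ l u}` of the ordered vector space whose unit interval is `E`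
(see `normDist_eq`). -/
noncomputable def normDist (a b : E) : ℝ :=
  sInf {t : ℝ | ∃ l : I, 0 < (l : ℝ) ∧ (l : ℝ) = t ∧ LeAdd l a b ∧ LeAdd l b a}

/-- Every Cauchy sequence in the order unit norm converges. -/
def NormComplete (E : Type u) [EffectAlgebra E] [ConvexStructure E] : Prop :=
  ∀ f : ℕ → E, (∀ ε : ℝ, 0 < ε → ∃ N, ∀ m ≥ N, ∀ n ≥ N, normDist (f m) (f n) < ε) →
    ∃ a : E, ∀ ε : ℝ, 0 < ε → ∃ N, ∀ n ≥ N, normDist (f n) a < ε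

/-- `Φ` identifies the convex effect algebra `E` with the interval `[0, w]` of the ordered vector
space `V`. -/
structure IsLinearRepresentation {V : Type v} [AddCommGroup V] [PartialOrder V] [Module ℝ V]
    (w : V) (Φ : E → V) : Prop where
  range_eq : Set.range Φ = Set.Icc 0 w
  map_one : Φ 1 = w
  perp_iff : ∀ a b, a ⟂ₑ b ↔ Φ a + Φ b ≤ w
  map_oplus : ∀ a b, a ⟂ₑ b → Φ (a ⊕ₑ b) = Φ a + Φ b
  map_scal : ∀ (l : I) (a : E), Φ (l •ₑ a) = (l : ℝ) • Φ a

/-- In every representation of `E` as an interval `[0, w]` of an ordered vector space, `normDist`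
is the distance of the order unit norm. -/
theorem normDist_eq {V : Type v} [AddCommGroup V] [PartialOrder V] [IsOrderedAddMonoid V]
    [Module ℝ V] [PosSMulMono ℝ V] {w : V} {Φ : E → V} (h : IsLinearRepresentation w Φ) (a b : E) :
    normDist a b = sInf {t : ℝ | 0 < t ∧ -(t • w) ≤ Φ a - Φ b ∧ Φ a - Φ b ≤ t • w} := by
  have hmem : ∀ a, 0 ≤ Φ a ∧ Φ a ≤ w := fun a => by
    have : Φ a ∈ Set.Icc 0 w := h.range_eq ▸ Set.mem_range_self a
    exact this
  have hw : 0 ≤ w := (hmem 0).1.trans (hmem 0).2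
  have hle : ∀ a b : E, Φ a ≤ Φ b → ∃ c : E, a ⟂ₑ c ∧ Φ (a ⊕ₑ c) = Φ b := by
    intro a b hab
    have : Φ b - Φ a ∈ Set.Icc 0 w :=
      ⟨sub_nonneg.2 hab, (sub_le_self _ (hmem a).1).trans (hmem b).2⟩
    rw [← h.range_eq] at this
    obtain ⟨c, hc⟩ := this
    have hp : a ⟂ₑ c := by rw [h.perp_iff, hc]; simpa using (hmem b).2
    exact ⟨c, hp, by rw [h.map_oplus _ _ hp, hc]; abel⟩
  have horth : ∀ a : E, Φ aᗮₑ = w - Φ a := fun a => by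
    have := h.map_oplus _ _ (perp_orth a)
    rw [oplus_orth, h.map_one] at this
    rw [this]; abel
  have hinj : ∀ a b : E, Φ a = Φ b → a = b := by
    intro a b hab
    have hp : a ⟂ₑ bᗮₑ := by rw [h.perp_iff, horth, hab]; simp
    have hp' : b ⟂ₑ aᗮₑ := by rw [h.perp_iff, horth, hab]; simp
    refine le_antisymm ?_ ?_
    · have := EffectAlgebra.perp_iff.1 hp
      rwa [orth_orth] at this
    · have := EffectAlgebra.perp_iff.1 hp'
      rwa [orth_orth] at this
  have hle' : ∀ a b : E, a ≼ b ↔ Φ a ≤ Φ b := by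
    intro a b
    constructor
    · rintro ⟨c, hc, rfl⟩
      rw [h.map_oplus _ _ hc]
      exact le_add_of_nonneg_right (hmem c).1
    · intro hab
      obtain ⟨c, hc, hcb⟩ := hle a b hab
      exact ⟨c, hc, hinj _ _ hcb⟩
  have hhalf : ((invSucc 1 : I) : ℝ) = 1 / 2 := by norm_num [invSucc]
  have hhalf_le : ∀ x y : V, (1 / 2 : ℝ) • x ≤ (1 / 2 : ℝ) • y ↔ x ≤ y := by
    intro x y
    constructor
    · intro hxy
      have := smul_le_smul_of_nonneg_left hxy (by norm_num : (0 : ℝ) ≤ 2)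
      simpa [smul_smul] using this
    · intro hxy
      exact smul_le_smul_of_nonneg_left hxy (by norm_num)
  have hlw : ∀ l : I, (l : ℝ) • w ≤ w := fun l => by
    have := hmem (l •ₑ (1 : E))
    rw [h.map_scal, h.map_one] at this
    exact this.2
  have hLe : ∀ (l : I) (a b : E), LeAdd l a b ↔ Φ a ≤ Φ b + (l : ℝ) • w := by
    intro l a b
    have hp : invSucc 1 •ₑ b ⟂ₑ invSucc 1 •ₑ l •ₑ (1 : E) := by
      rw [h.perp_iff, h.map_scal, h.map_scal, h.map_scal, h.map_one, hhalf, ← smul_add]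
      have : w = (1 / 2 : ℝ) • (w + w) := by rw [← two_smul ℝ w, smul_smul]; norm_num
      rw [this, hhalf_le, ← this]
      exact add_le_add (hmem b).2 (hlw l)
    unfold LeAdd
    rw [and_iff_right hp, hle', h.map_oplus _ _ hp, h.map_scal, h.map_scal, h.map_scal,
      h.map_scal, h.map_one, hhalf, ← smul_add, hhalf_le]
  have hiff : ∀ (t : ℝ) (ht : 0 < t) (ht1 : t ≤ 1),
      (-(t • w) ≤ Φ a - Φ b ∧ Φ a - Φ b ≤ t • w) ↔
        LeAdd ⟨t, ht.le, ht1⟩ a b ∧ LeAdd ⟨t, ht.le, ht1⟩ b a := by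
    intro t ht ht1
    rw [hLe, hLe, and_comm]
    refine and_congr ?_ ?_
    · rw [sub_le_iff_le_add, add_comm]
    · rw [neg_le_sub_iff_le_add]
  have h1 : (0 : ℝ) < 1 ∧ -((1 : ℝ) • w) ≤ Φ a - Φ b ∧ Φ a - Φ b ≤ (1 : ℝ) • w := by
    refine ⟨one_pos, ?_, ?_⟩
    · rw [one_smul, neg_le_sub_iff_le_add]
      exact (hmem b).2.trans (le_add_of_nonneg_left (hmem a).1)
    · rw [one_smul]
      exact (sub_le_self _ (hmem b).1).trans (hmem a).2
  apply _root_.le_antisymm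
  · apply le_csInf ⟨1, h1⟩
    rintro t ⟨ht, ht'⟩
    have hbdd : BddBelow {t : ℝ | ∃ l : I, 0 < (l : ℝ) ∧ (l : ℝ) = t ∧
        LeAdd l a b ∧ LeAdd l b a} := ⟨0, by rintro _ ⟨l, hl, rfl, _⟩; exact hl.le⟩
    rcases le_total t 1 with ht1 | ht1
    · exact csInf_le hbdd ⟨⟨t, ht.le, ht1⟩, ht, rfl, (hiff t ht ht1).1 ht'⟩
    · refine (csInf_le hbdd ⟨⟨1, one_pos.le, le_rfl⟩, one_pos, rfl, ?_⟩).trans ht1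
      exact (hiff 1 one_pos le_rfl).1 h1.2
  · refine le_csInf ⟨1, (⟨1, one_pos.le, le_rfl⟩ : I), one_pos, rfl,
      (hiff 1 one_pos le_rfl).1 h1.2⟩ ?_
    rintro _ ⟨l, hl, rfl, hl'⟩
    exact csInf_le ⟨0, fun _ h => h.1.le⟩ ⟨hl, (hiff l hl l.2.2).2 hl'⟩

end Norm

/-! ### Subalgebras, isomorphisms and the algebra `C(X, [0, 1])` -/

section Maps
variable {E : Type u} [EffectAlgebra E] [SequentialProduct E] [ConvexStructure E]
variable {F : Type v} [EffectAlgebra F] [SequentialProduct F] [ConvexStructure F]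

/-- A subalgebra: a convex sub-sequential effect algebra. -/
structure IsConvexSubSEA (S : Set E) : Prop extends IsSubEA S where
  seq_mem : ∀ a ∈ S, ∀ b ∈ S, a ∘ₑ b ∈ S
  scal_mem : ∀ (l : I), ∀ a ∈ S, l •ₑ a ∈ S

/-- `Φ` is an isomorphism of convex sequential effect algebras onto its range. -/
structure IsConvexSEAMono (Φ : E → F) : Prop where
  additive : IsAdditive Φ
  map_one : Φ 1 = 1
  perp_of_perp : ∀ a b, Φ a ⟂ₑ Φ b → a ⟂ₑ b
  map_seq : ∀ a b, Φ (a ∘ₑ b) = Φ a ∘ₑ Φ b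
  map_scal : ∀ (l : I) (a : E), Φ (l •ₑ a) = l •ₑ Φ a

/-- An isomorphism of convex sequential effect algebras. -/
structure IsConvexSEAIso (Φ : E → F) : Prop extends IsConvexSEAMono Φ where
  surjective : Function.Surjective Φ

end Maps

section CX
variable (X : Type u) [TopologicalSpace X]

/-- `C(X, [0, 1])`: `f ⊕ g = f + g`, defined if `f + g ≤ 1` (outside this domain the sum is
truncated, which is irrelevant). -/
noncomputable instance : EffectAlgebra C(X, I) where
  Perp f g := ∀ x, (f x : ℝ) + g x ≤ 1
  oplus f g := ⟨fun x => Set.projIcc 0 1 zero_le_one ((f x : ℝ) + g x), by fun_prop⟩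
  orth f := ⟨fun x => unitInterval.symm (f x), by fun_prop⟩
  comm f g h := ⟨fun x => by linarith [h x], by ext x; simp [add_comm]⟩
  assoc f g k h h' := by
    have e : ∀ f g : C(X, I), (∀ x, (f x : ℝ) + g x ≤ 1) → ∀ x,
        ((Set.projIcc 0 1 zero_le_one ((f x : ℝ) + g x) : I) : ℝ) = f x + g x := by
      intro f g h x
      rw [Set.projIcc_of_mem zero_le_one ⟨add_nonneg (f x).2.1 (g x).2.1, h x⟩]
    have h1 : ∀ x, (f x : ℝ) + g x + k x ≤ 1 := fun x => by
      have := h' x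
      simp only [ContinuousMap.coe_mk, e f g h] at this
      exact this
    have h2 : ∀ x, (g x : ℝ) + k x ≤ 1 := fun x => by linarith [h1 x, (f x).2.1]
    refine ⟨h2, fun x => ?_, ?_⟩
    · simp only [ContinuousMap.coe_mk, e g k h2]
      linarith [h1 x]
    · ext x
      simp only [ContinuousMap.coe_mk, e g k h2, e f g h, add_assoc]
  perp_orth f x := by simp
  oplus_orth f := by ext x; simp
  orth_unique f g h h' := by
    ext x
    have := congrArg (fun k : C(X, I) => (k x : ℝ)) h'
    simp only [ContinuousMap.coe_mk, ContinuousMap.one_apply] at this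
    rw [Set.projIcc_of_mem zero_le_one ⟨add_nonneg (f x).2.1 (g x).2.1, h x⟩] at this
    simp at this ⊢
    linarith
  eq_zero_of_perp_one f h := by
    ext x
    have := h x
    simp only [ContinuousMap.one_apply, Set.Icc.coe_one] at this
    simp only [ContinuousMap.zero_apply, Set.Icc.coe_zero]
    linarith [(f x).2.1]

theorem coe_oplus {X : Type u} [TopologicalSpace X] {f g : C(X, I)} (h : f ⟂ₑ g) (x : X) :
    ((f ⊕ₑ g) x : ℝ) = f x + g x := by
  show ((Set.projIcc 0 1 zero_le_one ((f x : ℝ) + g x) : I) : ℝ) = f x + g x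
  rw [Set.projIcc_of_mem zero_le_one ⟨add_nonneg (f x).2.1 (g x).2.1, h x⟩]

theorem coe_orth {X : Type u} [TopologicalSpace X] (f : C(X, I)) (x : X) :
    (fᗮₑ x : ℝ) = 1 - f x := rfl

/-- The sequential product of `C(X, [0, 1])` is the pointwise product. -/
noncomputable instance : SequentialProduct C(X, I) where
  seq f g := f * g
  seq_oplus f g k h := by
    have h1 : (f * g) ⟂ₑ (f * k) := fun x => by
      have := h x
      simp only [ContinuousMap.mul_apply, Set.Icc.coe_mul]
      nlinarith [(f x).2.1, (f x).2.2, (g x).2.1, (k x).2.1]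
    refine ⟨h1, ?_⟩
    ext x
    rw [coe_oplus h1]
    simp only [ContinuousMap.mul_apply, Set.Icc.coe_mul, coe_oplus h]
    ring
  one_seq f := one_mul f
  seq_eq_zero f g h := by rw [mul_comm, h]
  comm_orth _ _ _ := mul_comm _ _
  seq_assoc f g _ k := (mul_assoc f g k).symm
  comm_seq _ _ _ _ _ := mul_comm _ _
  comm_oplus _ _ _ _ _ _ := mul_comm _ _

/-- The convex structure of `C(X, [0, 1])` is pointwise multiplication by constants. -/
noncomputable instance : ConvexStructure C(X, I) where
  scal l f := ContinuousMap.const X l * f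
  scal_scal l m f := by ext x; simp; ring
  add_scal l m n f h := by
    have h1 : (ContinuousMap.const X l * f) ⟂ₑ (ContinuousMap.const X m * f) := fun x => by
      simp only [ContinuousMap.mul_apply, ContinuousMap.const_apply, Set.Icc.coe_mul]
      rw [← add_mul, h]
      exact mul_le_one₀ n.2.2 (f x).2.1 (f x).2.2
    refine ⟨h1, ?_⟩
    ext x
    rw [coe_oplus h1]
    simp only [ContinuousMap.mul_apply, ContinuousMap.const_apply, Set.Icc.coe_mul, ← h]
    ring
  scal_oplus l f g h := SequentialProduct.seq_oplus _ _ _ h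
  one_scal f := by ext x; simp

/-- A space is basically disconnected if the closure of every cozero set is open. -/
def BasicallyDisconnected (X : Type u) [TopologicalSpace X] : Prop :=
  ∀ f : C(X, ℝ), IsOpen (closure {x | f x ≠ 0})

end CX

end EffectAlgebra

/-! The representation is a Gelfand transform: `Spectrum E` is the compact space of multiplicative
states, and `gelfand a` evaluates them at `a`. Three facts carry it. Order is detected by states
(`exists_isState_lt`). Formal real combinations of elements of `E` carry a positive cone which
induces exactly the order of `E` (`le_of_isPositive`), and the strong archimedean property leaves
room for a Riesz extension argument. Extreme states are multiplicative
(`map_seq_of_mem_extremePoints`): by commutativity, `a` splits a state into a convex combination of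
two conditional states. Krein–Milman on the face where `φ a - φ b` is maximal then turns a
separating state into a separating multiplicative one (`exists_spectrum_lt`). The range is uniformly
dense by Stone–Weierstrass (`exists_near`). For the equivalences, either kind of completeness
upgrades density to surjectivity: norm completeness directly, monotone σ-completeness by
approximating from below with uniform control, so that the supremum is the pointwise limit
(`surjective_of_monotoneSigmaComplete`). What remains concerns `C(X, [0, 1])`. In a basically
disconnected space regularized suprema are continuous (`continuous_regularSup`), and closures of
cozero sets are clopen, so their indicators serve as projection covers and comparability
projections. Conversely, the closure of a cozero set is recovered as `{s > 0}`, with `s` a supremum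
of truncated multiples (`basicallyDisconnected`) or a projection cover
(`basicallyDisconnected_of_spectral`). -/

namespace EffectAlgebra

/-! ### Monotonicity and cancellation for the partial sum -/

section Order
variable {E : Type u} [EffectAlgebra E]

theorem perp_mono {a a' b b' : E} (h : a ⟂ₑ b) (ha : a' ≼ a) (hb : b' ≼ b) : a' ⟂ₑ b' := by
  have h1 : a' ⟂ₑ b := perp_iff.2 (le_trans ha (perp_iff.1 h))
  exact perp_iff.2 (le_trans (perp_iff.1 h1) (orth_le_orth hb))

theorem assoc' {a b c : E} (h : b ⟂ₑ c) (h' : a ⟂ₑ b ⊕ₑ c) :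
    a ⟂ₑ b ∧ (a ⊕ₑ b) ⟂ₑ c ∧ (a ⊕ₑ b) ⊕ₑ c = a ⊕ₑ (b ⊕ₑ c) := by
  have h1 := comm _ _ h
  have h2 := comm _ _ h'
  have h3 := assoc c b a h1.1 (by rw [← h1.2]; exact h2.1)
  have h4 := comm _ _ h3.1
  have h5 := comm _ _ h3.2.1
  rw [h4.2] at h5
  refine ⟨h4.1, h5.1, ?_⟩
  rw [← h5.2, h2.2, h1.2, h3.2.2, h4.2]

theorem oplus_le_oplus {a a' b b' : E} (h : a ⟂ₑ b) (ha : a' ≼ a) (hb : b' ≼ b) :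
    a' ⊕ₑ b' ≼ a ⊕ₑ b := by
  obtain ⟨c, hc, rfl⟩ := hb
  have h1 : a ⟂ₑ b' := perp_mono h (le_refl _) (le_oplus_left hc)
  have step : ∀ x y z : E, x ⟂ₑ z → y ≼ x → y ⊕ₑ z ≼ x ⊕ₑ z := by
    rintro _ y z h ⟨d, hd, rfl⟩
    have e := comm _ _ hd
    have e1 := assoc d y z e.1 (by rw [← e.2]; exact h)
    rw [e.2, e1.2.2]
    exact le_oplus_right e1.2.1
  refine le_trans (step _ _ _ h1 ha) ?_
  have e := assoc' hc h
  rw [← e.2.2]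
  exact le_oplus_left e.2.1

theorem le_of_oplus_le {a b c : E} (hb : a ⟂ₑ b) (hc : a ⟂ₑ c) (h : a ⊕ₑ b ≼ a ⊕ₑ c) :
    b ≼ c := by
  obtain ⟨d, hd, h⟩ := h
  have e := assoc _ _ _ hb hd
  rw [e.2.2] at h
  exact ⟨d, e.1, cancel e.2.1 hc h⟩

end Order

/-! ### Totalization of the partial sum -/

/-- An effect algebra with an absorbing element `none` adjoined, standing for undefined sums. -/
def PartialSum (E : Type u) : Type u := Option E

namespace PartialSum
variable {E : Type u}

/-- The embedding of an effect algebra into its totalization. -/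
def of (a : E) : PartialSum E := some a

theorem of_injective {a b : E} (h : of a = of b) : a = b := Option.some.inj h

theorem ext_of {x y : PartialSum E} (h : ∀ c, x = of c ↔ y = of c) : x = y :=
  Option.ext fun c => h c

variable [EffectAlgebra E]

open Classical in
/-- The sum of two elements, which is absorbing if it is undefined. -/
noncomputable def add : PartialSum E → PartialSum E → PartialSum E
  | some a, some b => if a ⟂ₑ b then some (a ⊕ₑ b) else none
  | _, _ => none

theorem add_eq_of {x y : PartialSum E} {c : E} :
    add x y = of c ↔ ∃ a b, x = of a ∧ y = of b ∧ a ⟂ₑ b ∧ a ⊕ₑ b = c := by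
  classical
  unfold of
  constructor
  · intro h
    match x, y, h with
    | some a, some b, h =>
      change (if a ⟂ₑ b then some (a ⊕ₑ b) else none) = some c at h
      split_ifs at h with hp
      exact ⟨a, b, rfl, rfl, hp, Option.some.inj h⟩
  · rintro ⟨a, b, rfl, rfl, hp, rfl⟩
    exact if_pos hp

/-- Associativity holds as an equality of possibly undefined sums, because definedness of either
bracketing implies that of the other (`assoc` and `assoc'`). This makes `Finset` sums available. -/
noncomputable instance : AddCommMonoid (PartialSum E) where
  add := add
  nsmul n x := @nsmulRec _ ⟨of 0⟩ ⟨add⟩ n x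
  zero := of 0
  add_assoc x y z := ext_of fun c => by
    refine ⟨fun h => ?_, fun h => ?_⟩
    · obtain ⟨d, e, h1, rfl, h2, rfl⟩ := add_eq_of.1 h
      obtain ⟨a, b, rfl, rfl, h3, rfl⟩ := add_eq_of.1 h1
      have h4 := assoc _ _ _ h3 h2
      exact add_eq_of.2 ⟨_, _, rfl, add_eq_of.2 ⟨_, _, rfl, rfl, h4.1, rfl⟩, h4.2.1, h4.2.2.symm⟩
    · obtain ⟨d, e, rfl, h1, h2, rfl⟩ := add_eq_of.1 h
      obtain ⟨a, b, rfl, rfl, h3, rfl⟩ := add_eq_of.1 h1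
      have h4 := assoc' h3 h2
      exact add_eq_of.2 ⟨_, _, add_eq_of.2 ⟨_, _, rfl, rfl, h4.1, rfl⟩, rfl, h4.2.1, h4.2.2⟩
  zero_add x := ext_of fun c => by
    refine ⟨fun h => ?_, fun h => ?_⟩
    · obtain ⟨a, b, h1, rfl, -, rfl⟩ := add_eq_of.1 h
      rw [← of_injective h1, (zero_perp b).2]
    · rw [h]
      exact add_eq_of.2 ⟨_, _, rfl, rfl, zero_perp c⟩
  add_zero x := ext_of fun c => by
    refine ⟨fun h => ?_, fun h => ?_⟩
    · obtain ⟨a, b, rfl, h1, -, rfl⟩ := add_eq_of.1 h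
      rw [← of_injective h1, (perp_zero a).2]
    · rw [h]
      exact add_eq_of.2 ⟨_, _, rfl, rfl, perp_zero c⟩
  add_comm x y := ext_of fun c => by
    have key : ∀ x y : PartialSum E, add x y = of c → add y x = of c := by
      intro x y h
      obtain ⟨a, b, rfl, rfl, h1, rfl⟩ := add_eq_of.1 h
      have h2 := comm _ _ h1
      exact add_eq_of.2 ⟨_, _, rfl, rfl, h2.1, h2.2.symm⟩
    exact ⟨key x y, key y x⟩

theorem add_eq_of_iff {x y : PartialSum E} {c : E} :
    x + y = of c ↔ ∃ a b, x = of a ∧ y = of b ∧ a ⟂ₑ b ∧ a ⊕ₑ b = c := add_eq_of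

theorem of_add_of {a b : E} (h : a ⟂ₑ b) : of a + of b = of (a ⊕ₑ b) :=
  add_eq_of_iff.2 ⟨_, _, rfl, rfl, h, rfl⟩

theorem of_zero : of (0 : E) = 0 := rfl

end PartialSum

/-! ### Scalars and nonnegative combinations -/

open scoped NNReal

section Mass
variable {E : Type u}

/-- The sum of the coefficients of a combination. -/
noncomputable def mass (w : E →₀ ℝ≥0) : ℝ≥0 := w.sum fun _ r => r

theorem mass_add (w w' : E →₀ ℝ≥0) : mass (w + w') = mass w + mass w' :=
  Finsupp.sum_add_index' (fun _ => rfl) (fun _ _ _ => rfl)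

theorem mass_smul (r : ℝ≥0) (w : E →₀ ℝ≥0) : mass (r • w) = r * mass w := by
  unfold mass
  rw [Finsupp.sum_smul_index (fun _ => rfl), Finsupp.mul_sum]

theorem mass_single (a : E) (r : ℝ≥0) : mass (Finsupp.single a r) = r :=
  Finsupp.sum_single_index rfl

theorem le_mass (w : E →₀ ℝ≥0) (a : E) : w a ≤ mass w := by
  by_cases h : a ∈ w.support
  · exact Finset.single_le_sum (f := fun a => w a) (fun _ _ => _root_.zero_le) h
  · rw [Finsupp.notMem_support_iff.1 h]; exact _root_.zero_le

end Mass

section Convex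
variable {E : Type u} [EffectAlgebra E] [ConvexStructure E]
open ConvexStructure

theorem zero_scal (a : E) : (0 : I) •ₑ a = 0 := by
  have h := add_scal 0 0 0 a (by simp)
  exact cancel h.1 (perp_zero _).1 (by rw [← h.2, (perp_zero _).2])

theorem scal_mono (l : I) {a b : E} (h : a ≼ b) : l •ₑ a ≼ l •ₑ b := by
  obtain ⟨c, hc, rfl⟩ := h
  exact ⟨l •ₑ c, (scal_oplus l a c hc).1, (scal_oplus l a c hc).2.symm⟩

/-- Multiplication by a nonnegative real number, which is truncated at `1`. -/
noncomputable def wt (r : ℝ≥0) (a : E) : E := (⟨min r 1, by positivity, by simp⟩ : I) •ₑ a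

theorem wt_eq_scal (l : I) (a : E) : wt ⟨l, l.2.1⟩ a = l •ₑ a := by
  unfold wt
  congr 1
  ext
  exact min_eq_left l.2.2

theorem wt_zero (a : E) : wt 0 a = 0 := by
  unfold wt
  convert zero_scal a
  simp

theorem wt_one (a : E) : wt 1 a = a := by
  unfold wt
  convert one_scal a
  simp

theorem wt_wt {r s : ℝ≥0} (hr : r ≤ 1) (hs : s ≤ 1) (a : E) : wt r (wt s a) = wt (r * s) a := by
  unfold wt
  rw [scal_scal]
  congr 1
  ext
  have h1 : (r : ℝ) ≤ 1 := hr
  have h2 : (s : ℝ) ≤ 1 := hs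
  have h3 : (r : ℝ) * s ≤ 1 := mul_le_one₀ h1 s.2 h2
  simp [h1, h2, h3, mul_comm]

theorem wt_add {r s : ℝ≥0} (h : r + s ≤ 1) (a : E) :
    wt r a ⟂ₑ wt s a ∧ wt (r + s) a = wt r a ⊕ₑ wt s a := by
  apply add_scal
  have h0 : (r : ℝ) + s ≤ 1 := mod_cast h
  have h1 : (r : ℝ) ≤ 1 := by linarith [s.2]
  have h2 : (s : ℝ) ≤ 1 := by linarith [r.2]
  simp [h0, h1, h2]

theorem wt_oplus (r : ℝ≥0) {a b : E} (h : a ⟂ₑ b) :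
    wt r a ⟂ₑ wt r b ∧ wt r (a ⊕ₑ b) = wt r a ⊕ₑ wt r b := scal_oplus _ _ _ h

theorem wt_mono (r : ℝ≥0) {a b : E} (h : a ≼ b) : wt r a ≼ wt r b := scal_mono _ h

theorem wt_perp {r s : ℝ≥0} (h : r + s ≤ 1) (a b : E) : wt r a ⟂ₑ wt s b :=
  perp_mono (wt_add h 1).1 (wt_mono _ (le_one a)) (wt_mono _ (le_one b))

theorem wt_half_add (a : E) : wt (1 / 2) a ⟂ₑ wt (1 / 2) a ∧ wt (1 / 2) a ⊕ₑ wt (1 / 2) a = a := by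
  have h := wt_add (r := 1 / 2) (s := 1 / 2) (by rw [add_halves]) a
  rw [add_halves, wt_one] at h
  exact ⟨h.1, h.2.symm⟩

theorem le_of_wt_half_le {a b : E} (h : wt (1 / 2) a ≼ wt (1 / 2) b) : a ≼ b := by
  have := oplus_le_oplus (wt_half_add b).1 h h
  rwa [(wt_half_add a).2, (wt_half_add b).2] at this

/-- Only the factor `1 / 2` can be undone directly, by adding a half to itself. Multiplying by `(1 /
2) ^ n / r ≤ 1` first replaces `r` by a power of `1 / 2`. -/
theorem le_of_wt_le {r : ℝ≥0} (hr : 0 < r) (hr1 : r ≤ 1) {a b : E} (h : wt r a ≼ wt r b) :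
    a ≼ b := by
  obtain ⟨n, hn⟩ := exists_pow_lt_of_lt_one hr (show (1 / 2 : ℝ≥0) < 1 from half_lt_self one_pos)
  have hhalf : (1 / 2 : ℝ≥0) ≤ 1 := half_le_self zero_le_one
  have h1 := wt_mono ((1 / 2) ^ n / r) h
  have h2 : (1 / 2 : ℝ≥0) ^ n / r ≤ 1 := (div_le_one₀ hr).2 hn.le
  rw [wt_wt h2 hr1, wt_wt h2 hr1, div_mul_cancel₀ _ hr.ne'] at h1
  clear hn h2 h
  induction n with
  | zero => simpa [wt_one] using h1
  | succ n ih =>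
    apply ih
    apply le_of_wt_half_le
    rwa [wt_wt hhalf (pow_le_one₀ (_root_.zero_le) hhalf), wt_wt hhalf (pow_le_one₀ (_root_.zero_le) hhalf),
      ← pow_succ']

/-- The value of a finite nonnegative combination of elements of `E`, if it is defined. -/
noncomputable def ev (w : E →₀ ℝ≥0) : PartialSum E := ∑ a ∈ w.support, PartialSum.of (wt (w a) a)

theorem ev_eq_sum (w : E →₀ ℝ≥0) {S : Finset E} (h : w.support ⊆ S) :
    ev w = ∑ a ∈ S, PartialSum.of (wt (w a) a) := by
  apply Finset.sum_subset h
  intro a _ ha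
  rw [Finsupp.notMem_support_iff.1 ha, wt_zero, PartialSum.of_zero]

/-- The mass bound keeps every coefficient at most `1`, so the truncation in `wt` never acts and
distributivity applies term by term. -/
theorem ev_add {w w' : E →₀ ℝ≥0} (h : mass (w + w') ≤ 1) : ev (w + w') = ev w + ev w' := by
  classical
  rw [ev_eq_sum (w + w') Finsupp.support_add, ev_eq_sum w (Finset.subset_union_left (s₂ := w'.support)),
    ev_eq_sum w' (Finset.subset_union_right (s₁ := w.support)), ← Finset.sum_add_distrib]
  refine Finset.sum_congr rfl fun a _ => ?_
  have h1 : w a + w' a ≤ 1 := (le_mass (w + w') a).trans h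
  rw [PartialSum.of_add_of (wt_add h1 a).1, Finsupp.add_apply, (wt_add h1 a).2]

theorem ev_single (a : E) (r : ℝ≥0) : ev (Finsupp.single a r) = PartialSum.of (wt r a) := by
  rw [ev_eq_sum _ Finsupp.support_single_subset, Finset.sum_singleton, Finsupp.single_eq_same]

theorem ev_zero : ev (0 : E →₀ ℝ≥0) = PartialSum.of 0 := by
  rw [ev]; simp [PartialSum.of_zero]

theorem ev_smul {r : ℝ≥0} (hr : r ≤ 1) {w : E →₀ ℝ≥0} (h : mass w ≤ 1) {e : E}
    (he : ev w = PartialSum.of e) : ev (r • w) = PartialSum.of (wt r e) := by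
  induction w using Finsupp.induction generalizing e with
  | zero =>
    rw [ev_zero] at he
    rw [smul_zero, ev_zero, ← PartialSum.of_injective he, ← wt_zero (0 : E)]
    rw [wt_wt hr zero_le_one, mul_zero]
  | single_add a s w _ _ ih =>
    have h' := h
    rw [mass_add, mass_single] at h'
    rw [ev_add h, ev_single] at he
    obtain ⟨b, c, hb, hc, hbc, rfl⟩ := PartialSum.add_eq_of_iff.1 he
    have h2 : mass (r • (Finsupp.single a s + w)) ≤ 1 := by
      rw [mass_smul]; exact mul_le_one' hr h
    rw [smul_add] at h2 ⊢
    have hs : s ≤ 1 := le_self_add.trans h'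
    rw [ev_add h2, ih (le_add_self.trans h') hc, Finsupp.smul_single, smul_eq_mul, ev_single,
      ← wt_wt hr hs, PartialSum.of_injective hb, PartialSum.of_add_of (wt_oplus r hbc).1,
      (wt_oplus r hbc).2]

end Convex
end EffectAlgebra

namespace EffectAlgebra
open scoped NNReal

section Mass
variable {E : Type u}

/-- A nonnegative combination as a formal real combination. -/
noncomputable def re (p : E →₀ ℝ≥0) : E →₀ ℝ := p.mapRange ((↑) : ℝ≥0 → ℝ) NNReal.coe_zero

theorem re_add (p q : E →₀ ℝ≥0) : re (p + q) = re p + re q := by ext; simp [re]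

theorem re_smul (r : ℝ≥0) (p : E →₀ ℝ≥0) : re (r • p) = (r : ℝ) • re p := by ext; simp [re]

theorem re_single (a : E) (r : ℝ≥0) : re (Finsupp.single a r) = Finsupp.single a (r : ℝ) := by
  simp [re]

theorem re_zero : re (0 : E →₀ ℝ≥0) = 0 := by simp [re]

theorem re_injective {p q : E →₀ ℝ≥0} (h : re p = re q) : p = q := by
  ext a
  simpa [re] using DFunLike.congr_fun h a

theorem mass_single_one (a : E) : mass (Finsupp.single a 1) ≤ 1 := (mass_single a 1).le

end Mass

/-! ### The cone of positive formal combinations -/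

section Positive
variable {E : Type u} [EffectAlgebra E] [ConvexStructure E]

/-- A formal real combination of elements of `E` is positive if a positive multiple of it is a
difference of two combinations with values `x` and `y` in `E` such that `y ≼ x`. -/
def IsPositive (w : E →₀ ℝ) : Prop :=
  ∃ t : ℝ≥0, 0 < t ∧ ∃ (p q : E →₀ ℝ≥0) (x y : E), mass p ≤ 1 ∧ mass q ≤ 1 ∧
    ev p = PartialSum.of x ∧ ev q = PartialSum.of y ∧ y ≼ x ∧ (t : ℝ) • w + re q = re p

theorem isPositive_zero : IsPositive (0 : E →₀ ℝ) :=
  ⟨1, one_pos, 0, 0, 0, 0, by simp [mass], by simp [mass], ev_zero, ev_zero, le_refl _, by simp⟩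

theorem IsPositive.smul {w : E →₀ ℝ} (h : IsPositive w) {c : ℝ} (hc : 0 ≤ c) :
    IsPositive (c • w) := by
  rcases hc.eq_or_lt with rfl | hc
  · rw [zero_smul]; exact isPositive_zero
  · obtain ⟨t, ht, p, q, x, y, h1, h2, h3, h4, h5, h6⟩ := h
    lift c to ℝ≥0 using hc.le
    have hc : 0 < c := hc
    refine ⟨t / c, by positivity, p, q, x, y, h1, h2, h3, h4, h5, ?_⟩
    rw [← h6, smul_smul, NNReal.coe_div, div_mul_cancel₀]
    exact_mod_cast hc.ne'

/-- The sum of the two values always exists: they lie below `wt r 1` and `wt s 1`, whose sum exists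
since `r + s ≤ 1`. -/
theorem ev_combination {r s : ℝ≥0} (h : r + s ≤ 1) {p q : E →₀ ℝ≥0} (hp : mass p ≤ 1)
    (hq : mass q ≤ 1) {x y : E} (hx : ev p = PartialSum.of x) (hy : ev q = PartialSum.of y) :
    mass (r • p + s • q) ≤ 1 ∧ ev (r • p + s • q) = PartialSum.of (wt r x ⊕ₑ wt s y) := by
  have hm : mass (r • p + s • q) ≤ 1 := by
    rw [mass_add, mass_smul, mass_smul]
    exact (add_le_add (mul_le_of_le_one_right' hp) (mul_le_of_le_one_right' hq)).trans h
  refine ⟨hm, ?_⟩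
  rw [ev_add hm, ev_smul (le_self_add.trans h) hp hx, ev_smul (le_add_self.trans h) hq hy,
    PartialSum.of_add_of (wt_perp h _ _)]

theorem IsPositive.add {w w' : E →₀ ℝ} (h : IsPositive w) (h' : IsPositive w') :
    IsPositive (w + w') := by
  obtain ⟨t, ht, p, q, x, y, h1, h2, h3, h4, h5, h6⟩ := h
  obtain ⟨t', ht', p', q', x', y', h1', h2', h3', h4', h5', h6'⟩ := h'
  -- The weights are crossed so that both `w` and `w'` end up with the same factor `t * t' / (t +
  -- t')`.
  have hs : t' / (t + t') + t / (t + t') = 1 := by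
    rw [← add_div, add_comm t' t, div_self (by positivity)]
  have hp := ev_combination hs.le h1 h1' h3 h3'
  have hq := ev_combination hs.le h2 h2' h4 h4'
  refine ⟨t * t' / (t + t'), by positivity, _, _, _, _, hp.1, hq.1, hp.2, hq.2,
    oplus_le_oplus (wt_perp hs.le _ _) (wt_mono _ h5) (wt_mono _ h5'), ?_⟩
  rw [re_add, re_add, re_smul, re_smul, re_smul, re_smul, ← h6, ← h6']
  push_cast
  module

/-- Positivity adds no new inequalities to `E`. The witness gives `q' + t p = p' + t q`. Dividing by
`1 + t` makes both sides evaluable, so up to this factor `y + t a = x + t b ≥ y + t b`; cancelling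
`y` and then the scalar leaves `b ≼ a`. -/
theorem le_of_isPositive {p q : E →₀ ℝ≥0} (hp : mass p ≤ 1) (hq : mass q ≤ 1) {a b : E}
    (ha : ev p = PartialSum.of a) (hb : ev q = PartialSum.of b) (h : IsPositive (re p - re q)) :
    b ≼ a := by
  obtain ⟨t, ht, p', q', x, y, h1, h2, h3, h4, h5, h6⟩ := h
  have hs : t / (1 + t) + 1 / (1 + t) = 1 := by
    rw [← add_div, add_comm t 1, div_self (by positivity)]
  have hs' : 1 / (1 + t) + t / (1 + t) = 1 := by rw [add_comm, hs]
  have e1 := ev_combination hs'.le h2 hp h4 ha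
  have e2 := ev_combination hs'.le h1 hq h3 hb
  have e : (1 / (1 + t)) • q' + (t / (1 + t)) • p = (1 / (1 + t)) • p' + (t / (1 + t)) • q := by
    apply re_injective
    rw [re_add, re_add, re_smul, re_smul, re_smul, re_smul, ← h6]
    push_cast
    module
  have e3 := e1.2
  rw [e, e2.2] at e3
  have e4 := PartialSum.of_injective e3
  have h8 := oplus_le_oplus (wt_perp hs'.le x b) (wt_mono _ h5) (le_refl _)
  rw [e4] at h8
  exact le_of_wt_le (by positivity) (le_add_self.trans hs'.le)
    (le_of_oplus_le (wt_perp hs'.le y b) (wt_perp hs'.le y a) h8)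

theorem isPositive_sub {p q : E →₀ ℝ≥0} (hp : mass p ≤ 1) (hq : mass q ≤ 1) {a b : E}
    (ha : ev p = PartialSum.of a) (hb : ev q = PartialSum.of b) (h : b ≼ a) :
    IsPositive (re p - re q) :=
  ⟨1, one_pos, p, q, a, b, hp, hq, ha, hb, h, by simp⟩

theorem ev_single_one (a : E) : ev (Finsupp.single a 1) = PartialSum.of a := by
  rw [ev_single, wt_one]

theorem isPositive_single (a : E) : IsPositive (Finsupp.single a (1 : ℝ)) := by
  have := isPositive_sub (mass_single_one a) (q := 0) (by simp [mass]) (ev_single_one a) ev_zero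
    (zero_le a)
  rwa [re_single, re_zero, sub_zero] at this

theorem isPositive_one_sub_single (a : E) :
    IsPositive (Finsupp.single 1 (1 : ℝ) - Finsupp.single a (1 : ℝ)) := by
  have := isPositive_sub (mass_single_one 1) (mass_single_one a) (ev_single_one 1)
    (ev_single_one a) (le_one a)
  rwa [re_single, re_single] at this

/-- The unit of `E` is an order unit for the cone; this supplies the cofinality condition of the
Riesz extension theorem. -/
theorem exists_isPositive_add_one (w : E →₀ ℝ) :
    ∃ r : ℝ, 0 ≤ r ∧ IsPositive (w + r • Finsupp.single 1 (1 : ℝ)) := by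
  induction w using Finsupp.induction_linear with
  | zero => exact ⟨0, le_rfl, by simpa using isPositive_zero⟩
  | add f g hf hg =>
    obtain ⟨r, hr, h⟩ := hf
    obtain ⟨s, hs, h'⟩ := hg
    refine ⟨r + s, add_nonneg hr hs, ?_⟩
    convert h.add h' using 1
    module
  | single a c =>
    have hc : (Finsupp.single a c : E →₀ ℝ) = c • Finsupp.single a (1 : ℝ) := by simp
    rcases le_total 0 c with h | h
    · refine ⟨0, le_rfl, ?_⟩
      rw [zero_smul, add_zero, hc]
      exact (isPositive_single a).smul h
    · refine ⟨-c, neg_nonneg.2 h, ?_⟩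
      convert (isPositive_one_sub_single a).smul (neg_nonneg.2 h) using 1
      rw [hc]
      module

/-- The formal sum of `a` and `b` has mass `2`, too large to evaluate, so the identity is checked on
halves and doubled. Having both signs forces functionals positive on the cone to be additive on `E`.
-/
theorem isPositive_oplus {a b : E} (h : a ⟂ₑ b) :
    IsPositive (Finsupp.single (a ⊕ₑ b) (1 : ℝ) - Finsupp.single a 1 - Finsupp.single b 1) ∧
    IsPositive (Finsupp.single a (1 : ℝ) + Finsupp.single b 1 - Finsupp.single (a ⊕ₑ b) 1) := by
  have hh : (1 / 2 : ℝ≥0) + 1 / 2 ≤ 1 := by rw [add_halves]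
  have h1 := ev_combination hh (mass_single_one a) (mass_single_one b) (ev_single_one a)
    (ev_single_one b)
  rw [← (wt_oplus _ h).2] at h1
  have h2 : mass (Finsupp.single (a ⊕ₑ b) (1 / 2 : ℝ≥0)) ≤ 1 := by
    rw [mass_single]; exact half_le_self zero_le_one
  have h3 := ev_single (a ⊕ₑ b) (1 / 2)
  have h4 := (isPositive_sub h2 h1.1 h3 h1.2 (le_refl _)).smul zero_le_two
  have h5 := (isPositive_sub h1.1 h2 h1.2 h3 (le_refl _)).smul zero_le_two
  rw [re_add, re_smul, re_smul, re_single, re_single, re_single] at h4 h5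
  have h6 : Finsupp.single (a ⊕ₑ b) (((1 / 2 : ℝ≥0) : ℝ)) =
      (1 / 2 : ℝ) • Finsupp.single (a ⊕ₑ b) (1 : ℝ) := by simp
  rw [h6] at h4 h5
  push_cast at h4 h5
  constructor
  · convert h4 using 1
    module
  · convert h5 using 1
    module

end Positive

/-! ### States -/

section State
variable {E : Type u} [EffectAlgebra E]

/-- A state: an additive map into the positive real numbers which preserves the unit. -/
structure IsState (φ : E → ℝ) : Prop where
  nonneg : ∀ a, 0 ≤ φ a
  map_oplus : ∀ a b, a ⟂ₑ b → φ (a ⊕ₑ b) = φ a + φ b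
  map_one : φ 1 = 1

theorem IsState.le_one {φ : E → ℝ} (h : IsState φ) (a : E) : φ a ≤ 1 := by
  have := h.map_oplus _ _ (perp_orth a)
  rw [oplus_orth, h.map_one] at this
  linarith [h.nonneg aᗮₑ]

variable [ConvexStructure E]

theorem scal_le (l : I) (a : E) : l •ₑ a ≼ a := by
  have := ConvexStructure.add_scal l (σ l) 1 a (by simp)
  rw [ConvexStructure.one_scal] at this
  have h := le_oplus_left this.1
  rwa [← this.2] at h

/-- Additive functionals are homogeneous. -/
theorem map_scal_of_additive {φ : E → ℝ} (h0 : ∀ a, 0 ≤ φ a)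
    (hadd : ∀ a b, a ⟂ₑ b → φ (a ⊕ₑ b) = φ a + φ b) (l : I) (a : E) : φ (l •ₑ a) = l * φ a := by
  have key : ∀ l m n : I, (l : ℝ) + m = n → φ (n •ₑ a) = φ (l •ₑ a) + φ (m •ₑ a) := by
    intro l m n h
    have h1 := ConvexStructure.add_scal l m n a h
    rw [h1.2, hadd _ _ h1.1]
  -- The defect `φ (l •ₑ a) - l * φ a` doubles when `l ≤ 1 / 2` is doubled and changes sign under `l
  -- ↦ 1 - l`, so every uniform bound for it can be halved.
  have bound : ∀ (n : ℕ) (l : I), |φ (l •ₑ a) - l * φ a| ≤ φ a * (1 / 2) ^ n := by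
    intro n
    induction n with
    | zero =>
      intro l
      have h1 := key l (σ l) 1 (by simp)
      rw [ConvexStructure.one_scal] at h1
      have h2 := h0 (l •ₑ a)
      have h3 := h0 (σ l •ₑ a)
      have h4 := mul_nonneg l.2.1 (h0 a)
      have h5 := mul_le_of_le_one_left (h0 a) l.2.2
      rw [abs_le]
      constructor <;> linarith
    | succ n ih =>
      have low : ∀ l : I, (l : ℝ) ≤ 1 / 2 → |φ (l •ₑ a) - l * φ a| ≤ φ a * (1 / 2) ^ (n + 1) := by
        intro l hl
        let m : I := ⟨l + l, by linarith [l.2.1], by linarith⟩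
        have h1 := key l l m rfl
        have h2 := ih m
        have hm : (m : ℝ) = l + l := rfl
        rw [h1, hm] at h2
        rw [abs_le] at h2 ⊢
        rw [pow_succ]
        constructor <;> linarith [h2.1, h2.2]
      intro l
      rcases le_total (l : ℝ) (1 / 2) with h | h
      · exact low l h
      · have h1 := low (σ l) (by rw [unitInterval.coe_symm_eq]; linarith)
        have h2 := key l (σ l) 1 (by simp)
        rw [ConvexStructure.one_scal] at h2
        rw [unitInterval.coe_symm_eq, abs_sub_comm] at h1
        convert h1 using 2
        linarith
  have hlim : Filter.Tendsto (fun n : ℕ => φ a * (1 / 2 : ℝ) ^ n) Filter.atTop (nhds (φ a * 0)) :=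
    (tendsto_pow_atTop_nhds_zero_of_lt_one (by norm_num) (by norm_num)).const_mul _
  rw [mul_zero] at hlim
  have h1 := ge_of_tendsto' hlim fun n => bound n l
  exact sub_eq_zero.1 (abs_eq_zero.1 (h1.antisymm (abs_nonneg _)))

/-- A Hahn–Banach separation. Strong archimedeanity yields `ε > 0` for which `v = (b + ε 1 - a) / 2`
is not positive. A normalized functional, positive on the cone enlarged by `-v`, then satisfies `φ b
+ ε ≤ φ a`. -/
theorem exists_isState_lt (harch : StronglyArchimedean E) {a b : E} (hab : ¬ a ≼ b) :
    ∃ φ : E → ℝ, IsState φ ∧ φ b < φ a := by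
  -- Halving all elements guarantees that the sums in the archimedean hypothesis exist.
  obtain ⟨n, hn⟩ : ∃ n : ℕ, ¬ wt (1 / 2) a ≼ wt (1 / 2) b ⊕ₑ invSucc n •ₑ wt (1 / 2) 1 := by
    by_contra! h
    refine hab (le_of_wt_half_le (harch _ _ (wt (1 / 2) 1) fun n => ⟨?_, h n⟩))
    refine perp_mono (wt_perp (add_halves (1 : ℝ≥0)).le b 1) (le_refl _) ?_
    exact scal_le (invSucc n) (wt (1 / 2) (1 : E))
  set ε : ℝ≥0 := ⟨invSucc n, (invSucc n).2.1⟩ with hε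
  have hε0 : 0 < (ε : ℝ) := by show 0 < 1 / ((n : ℝ) + 1); positivity
  have hε1 : ε ≤ 1 := (invSucc n).2.2
  have hh : (1 / 2 : ℝ≥0) ≤ 1 := half_le_self zero_le_one
  rw [← wt_eq_scal, ← hε] at hn
  have he := ev_combination (add_halves (1 : ℝ≥0)).le (mass_single_one b)
    (p := Finsupp.single b 1) (q := Finsupp.single 1 ε) (by rwa [mass_single])
    (ev_single_one b) (ev_single _ _)
  have ha : mass (Finsupp.single a (1 / 2 : ℝ≥0)) ≤ 1 := by rwa [mass_single]
  rw [wt_wt hh hε1, mul_comm, ← wt_wt hε1 hh] at he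
  set v : (E →₀ ℝ) := (1 / 2 : ℝ) • Finsupp.single b 1 + ((1 / 2 : ℝ) * ε) • Finsupp.single 1 1
    - (1 / 2 : ℝ) • Finsupp.single a 1 with hv
  have hvpos : ¬ IsPositive v := by
    intro h
    refine hn (le_of_isPositive he.1 ha he.2 (ev_single _ _) ?_)
    convert h using 1
    rw [re_add, re_smul, re_smul, re_single, re_single, re_single, hv]
    simp
  -- The cone generated by the positive combinations and `-v`.
  let K : PointedCone ℝ (E →₀ ℝ) :=
    { carrier := {w | ∃ s : ℝ, 0 ≤ s ∧ IsPositive (w + s • v)}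
      zero_mem' := ⟨0, le_rfl, by simpa using isPositive_zero⟩
      add_mem' := by
        rintro w w' ⟨s, hs, h⟩ ⟨s', hs', h'⟩
        refine ⟨s + s', add_nonneg hs hs', ?_⟩
        convert h.add h' using 1
        module
      smul_mem' := by
        rintro ⟨c, hc⟩ w ⟨s, hs, h⟩
        refine ⟨c * s, mul_nonneg hc hs, ?_⟩
        convert h.smul hc using 1
        rw [smul_add, smul_smul]
        rfl }
  have hK : ∀ w, IsPositive w → w ∈ K := fun w h => ⟨0, le_rfl, by simpa using h⟩
  have hne : (Finsupp.single 1 1 : E →₀ ℝ) ≠ 0 := by simp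
  let f : (E →₀ ℝ) →ₗ.[ℝ] ℝ := LinearPMap.mkSpanSingleton (Finsupp.single 1 1) (1 : ℝ) hne
  have hf : ∀ (c : ℝ) (h : c • Finsupp.single 1 1 ∈ f.domain),
      f ⟨c • Finsupp.single 1 1, h⟩ = c := by
    intro c h
    have : f ⟨c • Finsupp.single 1 1, h⟩ = RingHom.id ℝ c • (1 : ℝ) :=
      LinearPMap.mkSpanSingleton'_apply _ _ _ c h
    simpa using this
  have hdom : ∀ c : ℝ, c • (Finsupp.single 1 1 : E →₀ ℝ) ∈ f.domain := fun c =>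
    Submodule.mem_span_singleton.2 ⟨c, rfl⟩
  -- If `c • 1 ∈ K` with `c < 0`, then `v` would be positive. With `s = 0`, a negative multiple of
  -- the unit is positive and can be added to `v + r • 1`; with `s > 0`, adding `-c • 1` and
  -- dividing by `s` leaves `v`.
  obtain ⟨g, hgf, hg⟩ := riesz_extension K f (by
    rintro ⟨x, hx⟩ hxK
    obtain ⟨c, rfl⟩ := Submodule.mem_span_singleton.1 hx
    rw [hf]
    by_contra! hc
    obtain ⟨s, hs, h⟩ := hxK
    apply hvpos
    rcases hs.eq_or_lt with rfl | hs
    · obtain ⟨r, hr, h'⟩ := exists_isPositive_add_one v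
      convert h'.add (h.smul (div_nonneg hr (neg_nonneg.2 hc.le))) using 1
      simp only [zero_smul, add_zero]
      rw [smul_smul, div_neg, neg_mul, div_mul_cancel₀ _ hc.ne]
      module
    · have h2 := (isPositive_single (1 : E)).smul (neg_nonneg.2 hc.le)
      convert (h.add h2).smul (inv_nonneg.2 hs.le) using 1
      rw [show c • Finsupp.single (1 : E) (1 : ℝ) + s • v + -c • Finsupp.single (1 : E) (1 : ℝ)
        = s • v by module, smul_smul, inv_mul_cancel₀ hs.ne', one_smul]) (by
    intro y
    obtain ⟨r, hr, h⟩ := exists_isPositive_add_one y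
    refine ⟨⟨_, hdom r⟩, hK _ ?_⟩
    rwa [add_comm])
  have hg1 : g (Finsupp.single 1 1) = 1 := by
    have := hgf ⟨_, hdom 1⟩
    rw [hf] at this
    simpa using this
  refine ⟨fun x => g (Finsupp.single x 1), ⟨fun x => hg _ (hK _ (isPositive_single x)), ?_, hg1⟩, ?_⟩
  · intro x y hxy
    have h1 := hg _ (hK _ (isPositive_oplus hxy).1)
    have h2 := hg _ (hK _ (isPositive_oplus hxy).2)
    simp only [map_sub, map_add] at h1 h2
    linarith
  · have h1 : -v ∈ K := ⟨1, zero_le_one, by simpa using isPositive_zero⟩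
    have h2 := hg _ h1
    rw [hv] at h2
    simp only [map_neg, map_sub, map_add, map_smul, hg1, smul_eq_mul] at h2
    linarith

end State
end EffectAlgebra

namespace EffectAlgebra

/-! ### Multiplicative states and the Gelfand transform -/

section Spectrum
variable {E : Type u} [EffectAlgebra E]

theorem IsState.mono {φ : E → ℝ} (h : IsState φ) {a b : E} (hab : a ≼ b) : φ a ≤ φ b := by
  obtain ⟨c, hc, rfl⟩ := hab
  rw [h.map_oplus _ _ hc]
  linarith [h.nonneg c]

theorem IsState.map_orth {φ : E → ℝ} (h : IsState φ) (a : E) : φ aᗮₑ = 1 - φ a := by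
  have := h.map_oplus _ _ (perp_orth a)
  rw [oplus_orth, h.map_one] at this
  linarith

theorem isClosed_setOf_isState : IsClosed {φ : E → ℝ | IsState φ} := by
  have : {φ : E → ℝ | IsState φ} = {φ | ∀ a, 0 ≤ φ a} ∩
      {φ | ∀ a b, a ⟂ₑ b → φ (a ⊕ₑ b) = φ a + φ b} ∩ {φ | φ 1 = 1} := by
    ext φ
    exact ⟨fun h => ⟨⟨h.1, h.2⟩, h.3⟩, fun h => ⟨h.1.1, h.1.2, h.2⟩⟩
  rw [this]
  refine (IsClosed.inter ?_ ?_).inter ?_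
  · simp only [ofPred_forall]
    exact isClosed_iInter fun a => isClosed_le continuous_const (continuous_apply a)
  · simp only [ofPred_forall]
    exact isClosed_iInter fun a => isClosed_iInter fun b => isClosed_iInter fun _ =>
      isClosed_eq (continuous_apply _) ((continuous_apply a).add (continuous_apply b))
  · exact isClosed_eq (continuous_apply _) continuous_const

theorem isCompact_setOf_isState : IsCompact {φ : E → ℝ | IsState φ} :=
  (isCompact_univ_pi fun _ : E => isCompact_Icc (a := (0 : ℝ)) (b := 1)).of_isClosed_subset
    isClosed_setOf_isState fun _ h a _ => ⟨h.nonneg a, h.le_one a⟩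

variable [SequentialProduct E]

/-- The state `x ↦ φ (a ∘ x) / φ a`. -/
theorem IsState.conditional {φ : E → ℝ} (h : IsState φ) {a : E} (ha : φ a ≠ 0) :
    IsState fun x => φ (a ∘ₑ x) / φ a where
  nonneg x := div_nonneg (h.nonneg _) (h.nonneg _)
  map_oplus x y hxy := by
    have := SequentialProduct.seq_oplus a x y hxy
    rw [this.2, h.map_oplus _ _ this.1, add_div]
  map_one := by rw [seq_one, div_self ha]

/-- Extreme states of a commutative sequential effect algebra are multiplicative. -/
theorem map_seq_of_mem_extremePoints (hcomm : ∀ a b : E, a ∘ₑ b = b ∘ₑ a) {φ : E → ℝ}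
    (h : φ ∈ {φ : E → ℝ | IsState φ}.extremePoints ℝ) (a x : E) : φ (a ∘ₑ x) = φ a * φ x := by
  have hφ : IsState φ := h.1
  have hsum : φ x = φ (a ∘ₑ x) + φ (aᗮₑ ∘ₑ x) := by
    have h1 := SequentialProduct.seq_oplus x a aᗮₑ (perp_orth a)
    rw [oplus_orth, seq_one, hcomm x a, hcomm x] at h1
    rw [← hφ.map_oplus _ _ h1.1, ← h1.2]
  -- This settles the degenerate cases, in which one of the conditional states is not available.
  have zero : ∀ b : E, φ b = 0 → φ (b ∘ₑ x) = 0 := fun b hb =>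
    ((hφ.mono (seq_le b x)).trans hb.le).antisymm (hφ.nonneg _)
  by_cases h0 : φ a = 0
  · rw [zero a h0, h0, zero_mul]
  by_cases h1 : φ aᗮₑ = 0
  · rw [hsum, zero _ h1]
    rw [hφ.map_orth] at h1
    rw [← sub_eq_zero.1 h1]; ring
  -- Commutativity gives `φ y = φ (a ∘ₑ y) + φ (aᗮₑ ∘ₑ y)`, a convex combination of conditional
  -- states with weights `φ a` and `φ aᗮₑ`; extremality identifies the first one with `φ`.
  have hseg : φ ∈ openSegment ℝ (fun x => φ (a ∘ₑ x) / φ a)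
      (fun x => φ (aᗮₑ ∘ₑ x) / φ aᗮₑ) := by
    refine ⟨φ a, φ aᗮₑ, (hφ.nonneg _).lt_of_ne' h0, (hφ.nonneg _).lt_of_ne' h1, ?_, ?_⟩
    · rw [hφ.map_orth]; ring
    · ext y
      have h2 := SequentialProduct.seq_oplus y a aᗮₑ (perp_orth a)
      rw [oplus_orth, seq_one, hcomm y a, hcomm y] at h2
      simp only [Pi.add_apply, Pi.smul_apply, smul_eq_mul]
      rw [mul_div_cancel₀ _ h0, mul_div_cancel₀ _ h1, ← hφ.map_oplus _ _ h2.1, ← h2.2]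
  have h3 := congrFun (h.2 (hφ.conditional h0) (hφ.conditional h1) hseg) x
  rw [← h3, mul_div_cancel₀ _ h0]

variable (E) in
/-- The multiplicative states of a sequential effect algebra. -/
def Spectrum : Type u :=
  {φ : E → I // IsState (fun a => (φ a : ℝ)) ∧ ∀ a b, φ (a ∘ₑ b) = φ a * φ b}

instance : TopologicalSpace (Spectrum E) := instTopologicalSpaceSubtype

instance : T2Space (Spectrum E) := inferInstanceAs (T2Space (Subtype _))

instance : CompactSpace (Spectrum E) := by
  refine isCompact_iff_compactSpace.1 (IsClosed.isCompact ?_)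
  refine IsClosed.inter (s₂ := {φ : E → I | ∀ a b, φ (a ∘ₑ b) = φ a * φ b}) ?_ ?_
  · refine isClosed_setOf_isState.preimage (f := fun (φ : E → I) a => (φ a : ℝ)) ?_
    fun_prop
  · simp only [ofPred_forall]
    exact isClosed_iInter fun a => isClosed_iInter fun b =>
      isClosed_eq (continuous_apply _) ((continuous_apply a).mul (continuous_apply b))

/-- The element `a` as a function on the multiplicative states. -/
def gelfand (a : E) : C(Spectrum E, I) :=
  ⟨fun φ => φ.1 a, (continuous_apply a).comp continuous_subtype_val⟩

variable [ConvexStructure E]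

/-- The states maximizing `φ a - φ b` form a nonempty compact exposed face. By Krein–Milman it has
an extreme point, which is extreme among all states, hence multiplicative, and its value is positive
because some state separates. -/
theorem exists_spectrum_lt (hcomm : ∀ a b : E, a ∘ₑ b = b ∘ₑ a) (harch : StronglyArchimedean E)
    {a b : E} (hab : ¬ a ≼ b) : ∃ φ : Spectrum E, gelfand b φ < gelfand a φ := by
  let l : StrongDual ℝ (E → ℝ) := ContinuousLinearMap.proj (R := ℝ) (φ := fun _ : E => ℝ) a -
    ContinuousLinearMap.proj (R := ℝ) (φ := fun _ : E => ℝ) b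
  have hl : ∀ φ, l φ = φ a - φ b := fun φ => rfl
  obtain ⟨φ₀, hφ₀, hlt⟩ := exists_isState_lt harch hab
  obtain ⟨ψ, hψ, hmax⟩ := isCompact_setOf_isState.exists_isMaxOn ⟨φ₀, hφ₀⟩ l.continuous.continuousOn
  have hexp : IsExposed ℝ {φ : E → ℝ | IsState φ}
      {φ ∈ {φ : E → ℝ | IsState φ} | ∀ y ∈ {φ : E → ℝ | IsState φ}, l y ≤ l φ} :=
    fun _ => ⟨l, rfl⟩
  obtain ⟨φ, hφ⟩ := (hexp.isCompact isCompact_setOf_isState).extremePoints_nonempty ⟨ψ, hψ, hmax⟩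
  have h1 := hexp.isExtreme.extremePoints_subset_extremePoints hφ
  have h2 := hφ.1.2 φ₀ hφ₀
  have h3 : IsState φ := h1.1
  rw [hl, hl] at h2
  refine ⟨⟨fun x => ⟨φ x, h3.nonneg x, h3.le_one x⟩, h3, fun x y => ?_⟩, ?_⟩
  · exact Subtype.ext (map_seq_of_mem_extremePoints hcomm h1 x y)
  · show φ b < φ a
    linarith

theorem isConvexSEAMono_gelfand (hcomm : ∀ a b : E, a ∘ₑ b = b ∘ₑ a)
    (harch : StronglyArchimedean E) : IsConvexSEAMono (gelfand : E → C(Spectrum E, I)) where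
  additive a b h := by
    have h1 : ∀ φ : Spectrum E, (φ.1 (a ⊕ₑ b) : ℝ) = φ.1 a + φ.1 b := fun φ =>
      φ.2.1.map_oplus a b h
    have hp : gelfand a ⟂ₑ gelfand b := fun φ => by
      show (φ.1 a : ℝ) + φ.1 b ≤ 1
      rw [← h1]; exact (φ.1 _).2.2
    refine ⟨hp, ?_⟩
    ext φ
    rw [coe_oplus hp]
    exact h1 φ
  map_one := by
    ext φ
    exact φ.2.1.map_one
  perp_of_perp a b h := by
    by_contra hab
    rw [perp_iff] at hab
    obtain ⟨φ, hφ⟩ := exists_spectrum_lt hcomm harch hab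
    have h1 : ((φ.1 bᗮₑ : I) : ℝ) < φ.1 a := hφ
    have h2 : (φ.1 a : ℝ) + φ.1 b ≤ 1 := h φ
    have h3 := φ.2.1.map_orth b
    beta_reduce at h3
    linarith
  map_seq a b := by
    ext φ
    exact congrArg Subtype.val (φ.2.2 a b)
  map_scal l a := by
    ext φ
    exact map_scal_of_additive φ.2.1.nonneg φ.2.1.map_oplus l a

end Spectrum

/-! ### Subalgebras of `C(X, [0, 1])` -/

section Mono
variable {E : Type u} [EffectAlgebra E] [SequentialProduct E] [ConvexStructure E]
variable {F : Type v} [EffectAlgebra F] [SequentialProduct F] [ConvexStructure F]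
variable {Φ : E → F}

theorem IsConvexSEAMono.map_orth (h : IsConvexSEAMono Φ) (a : E) : Φ aᗮₑ = (Φ a)ᗮₑ := by
  have h1 := h.additive _ _ (perp_orth a)
  rw [oplus_orth, h.map_one] at h1
  exact orth_unique _ _ h1.1 h1.2.symm

theorem IsConvexSEAMono.map_zero (h : IsConvexSEAMono Φ) : Φ 0 = 0 := by
  rw [← orth_one, h.map_orth, h.map_one, orth_one]

theorem IsConvexSEAMono.le_iff (h : IsConvexSEAMono Φ) {a b : E} : Φ a ≼ Φ b ↔ a ≼ b := by
  constructor
  · intro hab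
    rw [← orth_orth b, ← perp_iff]
    apply h.perp_of_perp
    rwa [perp_iff, h.map_orth, orth_orth]
  · rintro ⟨c, hc, rfl⟩
    have := h.additive _ _ hc
    rw [this.2]
    exact le_oplus_left this.1

theorem IsConvexSEAMono.injective (h : IsConvexSEAMono Φ) : Function.Injective Φ := fun a b hab =>
  le_antisymm (h.le_iff.1 (by rw [hab]; exact le_refl _)) (h.le_iff.1 (by rw [hab]; exact le_refl _))

theorem IsConvexSEAMono.isConvexSubSEA_range (h : IsConvexSEAMono Φ) :
    IsConvexSubSEA (Set.range Φ) where
  zero_mem := ⟨0, h.map_zero⟩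
  one_mem := ⟨1, h.map_one⟩
  orth_mem := by rintro _ ⟨a, rfl⟩; exact ⟨aᗮₑ, h.map_orth a⟩
  oplus_mem := by
    rintro _ ⟨a, rfl⟩ _ ⟨b, rfl⟩ hab
    exact ⟨a ⊕ₑ b, (h.additive _ _ (h.perp_of_perp _ _ hab)).2⟩
  seq_mem := by rintro _ ⟨a, rfl⟩ _ ⟨b, rfl⟩; exact ⟨_, h.map_seq a b⟩
  scal_mem := by rintro l _ ⟨a, rfl⟩; exact ⟨_, h.map_scal l a⟩

end Mono
end EffectAlgebra

namespace EffectAlgebra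

/-! ### Calculus of represented functions and density -/

section Function
variable {X : Type v} [TopologicalSpace X]

theorem coe_seq (f g : C(X, I)) (x : X) : ((f ∘ₑ g) x : ℝ) = f x * g x := rfl

theorem coe_scal (l : I) (f : C(X, I)) (x : X) : ((l •ₑ f) x : ℝ) = l * f x := rfl

theorem le_iff_forall_le {f g : C(X, I)} : f ≼ g ↔ ∀ x, (f x : ℝ) ≤ g x := by
  constructor
  · rintro ⟨h, hh, rfl⟩ x
    rw [coe_oplus hh]
    linarith [(h x).2.1]
  · intro h
    rw [← orth_orth g, ← perp_iff]
    intro x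
    rw [coe_orth]
    linarith [h x]

variable {E : Type u} [EffectAlgebra E] [SequentialProduct E] [ConvexStructure E]
variable {Φ : E → C(X, I)}

namespace IsConvexSEAMono

theorem coe_oplus (h : IsConvexSEAMono Φ) {a b : E} (hab : a ⟂ₑ b) (x : X) :
    (Φ (a ⊕ₑ b) x : ℝ) = Φ a x + Φ b x := by
  have := h.additive a b hab
  rw [this.2, EffectAlgebra.coe_oplus this.1]

theorem coe_orth (h : IsConvexSEAMono Φ) (a : E) (x : X) : (Φ aᗮₑ x : ℝ) = 1 - Φ a x := by
  rw [h.map_orth, EffectAlgebra.coe_orth]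

theorem coe_scal (h : IsConvexSEAMono Φ) (l : I) (a : E) (x : X) :
    (Φ (l •ₑ a) x : ℝ) = l * Φ a x := by rw [h.map_scal, EffectAlgebra.coe_scal]

theorem coe_seq (h : IsConvexSEAMono Φ) (a b : E) (x : X) :
    (Φ (a ∘ₑ b) x : ℝ) = Φ a x * Φ b x := by rw [h.map_seq, EffectAlgebra.coe_seq]

theorem coe_one (h : IsConvexSEAMono Φ) (x : X) : (Φ 1 x : ℝ) = 1 := by rw [h.map_one]; rfl

theorem coe_zero (h : IsConvexSEAMono Φ) (x : X) : (Φ 0 x : ℝ) = 0 := by rw [h.map_zero]; rfl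

theorem le_iff_forall_le (h : IsConvexSEAMono Φ) {a b : E} :
    a ≼ b ↔ ∀ x, (Φ a x : ℝ) ≤ Φ b x := by
  rw [← h.le_iff, EffectAlgebra.le_iff_forall_le]

theorem perp_iff_forall (h : IsConvexSEAMono Φ) {a b : E} :
    a ⟂ₑ b ↔ ∀ x, (Φ a x : ℝ) + Φ b x ≤ 1 :=
  ⟨fun hab => (h.additive a b hab).1, fun hab => h.perp_of_perp a b hab⟩

theorem exists_sub (h : IsConvexSEAMono Φ) {a b : E} (hab : ∀ x, (Φ a x : ℝ) ≤ Φ b x) :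
    ∃ c : E, ∀ x, (Φ c x : ℝ) = Φ b x - Φ a x := by
  obtain ⟨c, hc, rfl⟩ := h.le_iff_forall_le.2 hab
  exact ⟨c, fun x => by rw [h.coe_oplus hc]; ring⟩

theorem exists_add (h : IsConvexSEAMono Φ) {a b : E} (hab : ∀ x, (Φ a x : ℝ) + Φ b x ≤ 1) :
    ∃ c : E, ∀ x, (Φ c x : ℝ) = Φ a x + Φ b x :=
  ⟨a ⊕ₑ b, h.coe_oplus (h.perp_iff_forall.2 hab)⟩

theorem exists_const (h : IsConvexSEAMono Φ) {r : ℝ} (h0 : 0 ≤ r) (h1 : r ≤ 1) :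
    ∃ c : E, ∀ x, (Φ c x : ℝ) = r :=
  ⟨(⟨r, h0, h1⟩ : I) •ₑ 1, fun x => by rw [h.coe_scal, h.coe_one, mul_one]⟩

theorem exists_avg (h : IsConvexSEAMono Φ) (a b : E) :
    ∃ c : E, ∀ x, (Φ c x : ℝ) = (Φ a x + Φ b x) / 2 := by
  let l : I := ⟨1 / 2, by norm_num, by norm_num⟩
  have hl : (l : ℝ) = 1 / 2 := rfl
  obtain ⟨c, hc⟩ := h.exists_add (a := l •ₑ a) (b := l •ₑ b) fun x => by
    rw [h.coe_scal, h.coe_scal, hl]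
    linarith [(Φ a x).2.2, (Φ b x).2.2]
  exact ⟨c, fun x => by rw [hc, h.coe_scal, h.coe_scal, hl]; ring⟩

theorem exists_two_pow_mul (h : IsConvexSEAMono Φ) (n : ℕ) {a : E}
    (ha : ∀ x, 2 ^ n * (Φ a x : ℝ) ≤ 1) : ∃ c : E, ∀ x, (Φ c x : ℝ) = 2 ^ n * Φ a x := by
  induction n generalizing a with
  | zero => exact ⟨a, fun x => by simp⟩
  | succ n ih =>
    obtain ⟨b, hb⟩ := h.exists_add (a := a) (b := a) fun x => by
      have h1 := ha x
      have h2 : (1 : ℝ) ≤ 2 ^ n := one_le_pow₀ one_le_two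
      rw [pow_succ] at h1
      nlinarith [(Φ a x).2.1]
    obtain ⟨c, hc⟩ := ih (a := b) fun x => by
      rw [hb]
      have h1 := ha x
      rw [pow_succ] at h1
      linarith
    exact ⟨c, fun x => by rw [hc, hb]; ring⟩

/-- Division by `t` is a scalar multiplication by `(1 / 2) ^ n / t ≤ 1` followed by `n` doublings,
all defined because the result stays at most `1`. -/
theorem exists_div (h : IsConvexSEAMono Φ) {t : ℝ} (ht : 0 < t) {a : E}
    (ha : ∀ x, (Φ a x : ℝ) ≤ t) : ∃ c : E, ∀ x, t * (Φ c x : ℝ) = Φ a x := by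
  obtain ⟨n, hn⟩ := exists_pow_lt_of_lt_one ht (show (1 / 2 : ℝ) < 1 by norm_num)
  let l : I := ⟨(1 / 2) ^ n / t, by positivity, (div_le_one₀ ht).2 hn.le⟩
  have hl : 2 ^ n * (l : ℝ) = 1 / t := by
    show 2 ^ n * ((1 / 2) ^ n / t) = 1 / t
    rw [mul_div_assoc', ← mul_pow]
    norm_num
  obtain ⟨c, hc⟩ := h.exists_two_pow_mul n (a := l •ₑ a) fun x => by
    rw [h.coe_scal, ← mul_assoc, hl, one_div_mul_eq_div]
    exact (div_le_one₀ ht).2 (ha x)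
  refine ⟨c, fun x => ?_⟩
  rw [hc, h.coe_scal, ← mul_assoc (2 ^ n), hl]
  field_simp

/-- The algebra of functions generated by the range of `Φ`. -/
def subalgebra (h : IsConvexSEAMono Φ) : Subalgebra ℝ C(X, ℝ) where
  carrier := {f | ∃ t : I, 0 < (t : ℝ) ∧ ∃ a b : E, ∀ x, t * f x = Φ a x - Φ b x}
  add_mem' := by
    rintro f g ⟨t, ht, a, b, hf⟩ ⟨s, hs, c, d, hg⟩
    -- Sums over the common denominator may be undefined in `E`, so averages are used and the
    -- denominator absorbs the factor `1 / 2`.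
    obtain ⟨p, hp⟩ := h.exists_avg (s •ₑ a) (t •ₑ c)
    obtain ⟨q, hq⟩ := h.exists_avg (s •ₑ b) (t •ₑ d)
    refine ⟨⟨t * s / 2, by positivity, by nlinarith [t.2.1, t.2.2, s.2.1, s.2.2]⟩,
      by positivity, p, q, fun x => ?_⟩
    rw [hp, hq, h.coe_scal, h.coe_scal, h.coe_scal, h.coe_scal, ContinuousMap.add_apply]
    linear_combination (s / 2 : ℝ) * hf x + (t / 2 : ℝ) * hg x
  mul_mem' := by
    rintro f g ⟨t, ht, a, b, hf⟩ ⟨s, hs, c, d, hg⟩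
    obtain ⟨p, hp⟩ := h.exists_avg (a ∘ₑ c) (b ∘ₑ d)
    obtain ⟨q, hq⟩ := h.exists_avg (a ∘ₑ d) (b ∘ₑ c)
    refine ⟨⟨t * s / 2, by positivity, by nlinarith [t.2.1, t.2.2, s.2.1, s.2.2]⟩,
      by positivity, p, q, fun x => ?_⟩
    rw [hp, hq, h.coe_seq, h.coe_seq, h.coe_seq, h.coe_seq, ContinuousMap.mul_apply]
    linear_combination (s * g x / 2 : ℝ) * hf x + ((Φ a x - Φ b x) / 2 : ℝ) * hg x
  algebraMap_mem' r := by
    have hr : 0 < 1 + |r| := by positivity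
    obtain ⟨a, ha⟩ := h.exists_const (r := max r 0 / (1 + |r|)) (by positivity)
      ((div_le_one₀ hr).2 (max_le (by linarith [le_abs_self r]) hr.le))
    obtain ⟨b, hb⟩ := h.exists_const (r := max (-r) 0 / (1 + |r|)) (by positivity)
      ((div_le_one₀ hr).2 (max_le (by linarith [neg_abs_le r]) hr.le))
    refine ⟨⟨1 / (1 + |r|), by positivity, (div_le_one₀ hr).2 (by linarith [abs_nonneg r])⟩,
      by positivity, a, b, fun x => ?_⟩
    rw [ha, hb, ← sub_div, max_zero_sub_max_neg_zero_eq_self]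
    exact one_div_mul_eq_div _ _

/-- Stone–Weierstrass gives an approximant in the generated algebra, which need not take values in
`[0, 1]`. Approximating `(1 - δ) f + δ / 2` within `δ / 2` forces values in `(0, 1)` at a total cost
of at most `δ`; subtraction and division then stay inside `E`. -/
theorem exists_near [CompactSpace X] (h : IsConvexSEAMono Φ)
    (hsep : ∀ x y : X, x ≠ y → ∃ a, Φ a x ≠ Φ a y) (f : C(X, I)) {ε : ℝ} (hε : 0 < ε) :
    ∃ a, ∀ x, |(Φ a x : ℝ) - f x| < ε := by
  have hA : h.subalgebra.SeparatesPoints := by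
    intro x y hxy
    obtain ⟨a, ha⟩ := hsep x y hxy
    refine ⟨_, ⟨⟨fun x => (Φ a x : ℝ), by fun_prop⟩, ⟨1, one_pos, a, 0, fun x => ?_⟩, rfl⟩, ?_⟩
    · simp [h.coe_zero]
    · exact fun h' => ha (Subtype.ext h')
  obtain ⟨δ, hδ, hδε, hδ1⟩ : ∃ δ : ℝ, 0 < δ ∧ δ < ε ∧ δ ≤ 1 :=
    ⟨min (ε / 2) 1, by positivity, (min_le_left _ _).trans_lt (by linarith), min_le_right _ _⟩
  obtain ⟨⟨g, t, ht, a, b, hg⟩, hgf⟩ :=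
    ContinuousMap.exists_mem_subalgebra_near_continuous_of_separatesPoints h.subalgebra hA
      (fun x => (1 - δ) * (f x : ℝ) + δ / 2) (by fun_prop) (δ / 2) (by positivity)
  have hg' : ∀ x, 0 < g x ∧ g x < 1 ∧ |g x - f x| ≤ δ := fun x => by
    have h1 := hgf x
    rw [Real.norm_eq_abs, abs_lt] at h1
    have h2 : g x < (1 - δ) * f x + δ / 2 + δ / 2 := by linarith [h1.2]
    have h3 : (1 - δ) * f x + δ / 2 - δ / 2 < g x := by linarith [h1.1]
    have h4 := (f x).2.1
    have h5 := (f x).2.2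
    rw [abs_le]
    refine ⟨by nlinarith, by nlinarith, by nlinarith, by nlinarith⟩
  obtain ⟨c, hc⟩ := h.exists_sub (a := b) (b := a) fun x => by
    have := mul_pos ht (hg' x).1
    linarith [hg x]
  obtain ⟨d, hd⟩ := h.exists_div ht (a := c) fun x => by
    rw [hc, ← hg]
    exact mul_le_of_le_one_right ht.le (hg' x).2.1.le
  refine ⟨d, fun x => ?_⟩
  have h1 : (Φ d x : ℝ) = g x := by
    have := hd x
    rw [hc, ← hg] at this
    exact mul_left_cancel₀ ht.ne' this
  rw [h1]
  exact (hg' x).2.2.trans_lt hδε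

/-! #### The order unit norm -/

theorem leAdd_iff (h : IsConvexSEAMono Φ) {l : I} {a b : E} :
    LeAdd l a b ↔ ∀ x, (Φ a x : ℝ) ≤ Φ b x + l := by
  have hhalf : ((invSucc 1 : I) : ℝ) = 1 / 2 := by norm_num [invSucc]
  have hp : invSucc 1 •ₑ b ⟂ₑ invSucc 1 •ₑ l •ₑ (1 : E) := by
    rw [h.perp_iff_forall]
    intro x
    rw [h.coe_scal, h.coe_scal, h.coe_scal, h.coe_one, hhalf]
    linarith [(Φ b x).2.2, l.2.2]
  unfold LeAdd
  rw [and_iff_right hp, h.le_iff_forall_le]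
  refine forall_congr' fun x => ?_
  rw [h.coe_oplus hp, h.coe_scal, h.coe_scal, h.coe_scal, h.coe_scal, h.coe_one, hhalf]
  constructor <;> intro h <;> linarith

theorem normDist_le (h : IsConvexSEAMono Φ) {a b : E} {t : ℝ} (ht : 0 < t)
    (hab : ∀ x, |(Φ a x : ℝ) - Φ b x| ≤ t) : normDist a b ≤ t := by
  have hbdd : BddBelow {t : ℝ | ∃ l : I, 0 < (l : ℝ) ∧ (l : ℝ) = t ∧
      LeAdd l a b ∧ LeAdd l b a} := ⟨0, by rintro _ ⟨l, hl, rfl, _⟩; exact hl.le⟩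
  -- `LeAdd` only takes scalars in `[0, 1]`, and differences of values never exceed `1`.
  have h1 : 0 < min t 1 := lt_min ht one_pos
  refine (csInf_le hbdd ⟨⟨min t 1, h1.le, min_le_right _ _⟩, h1, rfl, ?_⟩).trans (min_le_left _ _)
  have h2 : ∀ x, |(Φ a x : ℝ) - Φ b x| ≤ min t 1 := fun x => le_min (hab x) <| by
    rw [abs_le]
    constructor <;> linarith [(Φ a x).2.1, (Φ a x).2.2, (Φ b x).2.1, (Φ b x).2.2]
  rw [h.leAdd_iff, h.leAdd_iff]
  exact ⟨fun x => by linarith [(abs_le.1 (h2 x)).2], fun x => by linarith [(abs_le.1 (h2 x)).1]⟩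

theorem abs_sub_lt (h : IsConvexSEAMono Φ) {a b : E} {t : ℝ} (hab : normDist a b < t) (x : X) :
    |(Φ a x : ℝ) - Φ b x| < t := by
  have h0 : ∀ a b : E, LeAdd 1 a b := fun a b => h.leAdd_iff.2 fun x => by
    rw [Set.Icc.coe_one]
    linarith [(Φ a x).2.2, (Φ b x).2.1]
  have hne : {t : ℝ | ∃ l : I, 0 < (l : ℝ) ∧ (l : ℝ) = t ∧ LeAdd l a b ∧ LeAdd l b a}.Nonempty :=
    ⟨1, 1, one_pos, rfl, h0 a b, h0 b a⟩
  obtain ⟨_, ⟨l, hl, rfl, h1, h2⟩, hlt⟩ := exists_lt_of_csInf_lt hne hab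
  rw [abs_lt]
  constructor <;> linarith [h.leAdd_iff.1 h1 x, h.leAdd_iff.1 h2 x]

/-- Approximants of `f` are uniformly Cauchy, hence Cauchy for `normDist`, and their limit in `E`
must represent `f`. -/
theorem surjective_of_normComplete (h : IsConvexSEAMono Φ)
    (hdense : ∀ (f : C(X, I)) (ε : ℝ), 0 < ε → ∃ a, ∀ x, |(Φ a x : ℝ) - f x| < ε)
    (hE : NormComplete E) : Function.Surjective Φ := by
  intro f
  choose a ha using fun n : ℕ => hdense f (1 / ((n : ℝ) + 1)) (by positivity)
  have lim : ∀ ε : ℝ, 0 < ε → ∃ N : ℕ, ∀ n ≥ N, 1 / ((n : ℝ) + 1) < ε := fun ε hε => by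
    obtain ⟨N, hN⟩ := exists_nat_one_div_lt hε
    exact ⟨N, fun n hn => (Nat.one_div_le_one_div hn).trans_lt hN⟩
  obtain ⟨b, hb⟩ := hE a fun ε hε => by
    obtain ⟨N, hN⟩ := lim (ε / 3) (by positivity)
    refine ⟨N, fun m hm n hn => lt_of_le_of_lt (h.normDist_le (t := 2 * (ε / 3)) (by positivity)
      fun x => ?_) (by linarith)⟩
    have h1 := abs_lt.1 ((ha m x).trans (hN m hm))
    have h2 := abs_lt.1 ((ha n x).trans (hN n hn))
    rw [abs_le]
    constructor <;> linarith [h1.1, h1.2, h2.1, h2.2]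
  refine ⟨b, ContinuousMap.ext fun x => Subtype.ext ?_⟩
  refine eq_of_forall_dist_le fun ε hε => ?_
  obtain ⟨N, hN⟩ := lim (ε / 2) (by positivity)
  obtain ⟨M, hM⟩ := hb (ε / 2) (by positivity)
  have h1 := abs_lt.1 ((ha (max N M) x).trans (hN _ (le_max_left _ _)))
  have h2 := abs_lt.1 (h.abs_sub_lt (hM _ (le_max_right N M)) x)
  rw [Real.dist_eq, abs_le]
  constructor <;> linarith [h1.1, h1.2, h2.1, h2.2]

theorem normComplete_of_surjective [CompactSpace X] (h : IsConvexSEAMono Φ)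
    (hsurj : Function.Surjective Φ) : NormComplete E := by
  intro f hf
  have hc : CauchySeq fun n => Φ (f n) := by
    rw [Metric.cauchySeq_iff]
    intro ε hε
    obtain ⟨N, hN⟩ := hf ε hε
    refine ⟨N, fun m hm n hn => ?_⟩
    rw [ContinuousMap.dist_lt_iff hε]
    exact h.abs_sub_lt (hN m hm n hn)
  obtain ⟨g, hg⟩ := cauchySeq_tendsto_of_complete hc
  obtain ⟨a, rfl⟩ := hsurj g
  refine ⟨a, fun ε hε => ?_⟩
  obtain ⟨N, hN⟩ := Metric.tendsto_atTop.1 hg (ε / 2) (by positivity)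
  refine ⟨N, fun n hn => lt_of_le_of_lt (h.normDist_le (t := ε / 2) (by positivity) fun x => ?_)
    (by linarith)⟩
  exact ((ContinuousMap.dist_lt_iff (by positivity)).1 (hN n hn) x).le

end IsConvexSEAMono
end Function
end EffectAlgebra

namespace EffectAlgebra

/-! ### Monotone completeness -/

section Disconnected
variable {X : Type v} [TopologicalSpace X]

/-- In a basically disconnected space, the closure of a countable union of sets `{r < f n}` is
open. -/
theorem BasicallyDisconnected.isOpen_closure_iUnion (hX : BasicallyDisconnected X)
    (f : ℕ → C(X, I)) (r : ℝ) : IsOpen (closure {x | ∃ n, r < f n x}) := by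
  have hbound : ∀ n x, |(1 / 2 : ℝ) ^ n * max ((f n x : ℝ) - r) 0| ≤ (1 / 2) ^ n * (1 + |r|) := by
    intro n x
    rw [abs_of_nonneg (by positivity)]
    gcongr
    exact max_le (by linarith [(f n x).2.2, neg_abs_le r]) (by positivity)
  have hsum : Summable fun n : ℕ => (1 / 2 : ℝ) ^ n * (1 + |r|) :=
    (summable_geometric_of_lt_one (by norm_num) (by norm_num)).mul_right _
  -- All terms are nonnegative, so the cozero set of this uniformly convergent series is exactly the
  -- union of the sets `{r < f n}`.
  let g : C(X, ℝ) := ⟨fun x => ∑' n, (1 / 2 : ℝ) ^ n * max ((f n x : ℝ) - r) 0,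
    continuous_tsum (fun n => by fun_prop) hsum hbound⟩
  convert hX g using 3
  ext x
  have hx : Summable fun n : ℕ => (1 / 2 : ℝ) ^ n * max ((f n x : ℝ) - r) 0 :=
    Summable.of_norm_bounded hsum fun n => hbound n x
  have h0 : ∀ n : ℕ, 0 ≤ (1 / 2 : ℝ) ^ n * max ((f n x : ℝ) - r) 0 := fun n => by positivity
  show (∃ n, r < f n x) ↔ ∑' n, (1 / 2 : ℝ) ^ n * max ((f n x : ℝ) - r) 0 ≠ 0
  constructor
  · rintro ⟨n, hn⟩
    refine (lt_of_lt_of_le ?_ (hx.le_tsum n fun m _ => h0 m)).ne'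
    have : 0 < max ((f n x : ℝ) - r) 0 := lt_max_of_lt_left (sub_pos.2 hn)
    positivity
  · intro h
    by_contra! hn
    apply h
    simp [hn]

/-- The pointwise supremum of a sequence of functions, made continuous. -/
noncomputable def regularSup (f : ℕ → C(X, I)) (x : X) : ℝ :=
  sSup {r : ℝ | x ∈ closure {y | ∃ n, r < f n y}}

theorem mem_closure_of_neg (f : ℕ → C(X, I)) (x : X) {r : ℝ} (hr : r < 0) :
    x ∈ closure {y | ∃ n, r < f n y} :=
  subset_closure ⟨0, hr.trans_le (f 0 x).2.1⟩

theorem lt_one_of_mem_closure {f : ℕ → C(X, I)} {x : X} {r : ℝ}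
    (h : x ∈ closure {y | ∃ n, r < f n y}) : r < 1 := by
  obtain ⟨y, n, hy⟩ := closure_nonempty_iff.1 ⟨x, h⟩
  exact hy.trans_le (f n y).2.2

theorem bddAbove_regularSup (f : ℕ → C(X, I)) (x : X) :
    BddAbove {r : ℝ | x ∈ closure {y | ∃ n, r < f n y}} :=
  ⟨1, fun _ h => (lt_one_of_mem_closure h).le⟩

theorem nonempty_regularSup (f : ℕ → C(X, I)) (x : X) :
    {r : ℝ | x ∈ closure {y | ∃ n, r < f n y}}.Nonempty :=
  ⟨-1, mem_closure_of_neg f x (by norm_num)⟩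

theorem regularSup_mem (f : ℕ → C(X, I)) (x : X) : regularSup f x ∈ I := by
  refine ⟨?_, csSup_le (nonempty_regularSup f x) fun _ h => (lt_one_of_mem_closure h).le⟩
  refine le_of_forall_lt fun r hr => ?_
  obtain ⟨s, hrs, hs⟩ := exists_between hr
  exact hrs.trans_le (le_csSup (bddAbove_regularSup f x) (mem_closure_of_neg f x hs))

theorem lt_regularSup_iff {f : ℕ → C(X, I)} {x : X} {r : ℝ} :
    r < regularSup f x ↔ ∃ s, r < s ∧ x ∈ closure {y | ∃ n, s < f n y} := by
  constructor
  · intro h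
    obtain ⟨s, hs, hrs⟩ := exists_lt_of_lt_csSup (nonempty_regularSup f x) h
    exact ⟨s, hrs, hs⟩
  · rintro ⟨s, hrs, hs⟩
    exact hrs.trans_le (le_csSup (bddAbove_regularSup f x) hs)

theorem regularSup_lt_iff {f : ℕ → C(X, I)} {x : X} {r : ℝ} :
    regularSup f x < r ↔ ∃ s, s < r ∧ x ∉ closure {y | ∃ n, s < f n y} := by
  constructor
  · intro h
    obtain ⟨s, h1, h2⟩ := exists_between h
    exact ⟨s, h2, fun hs => h1.not_ge (le_csSup (bddAbove_regularSup f x) hs)⟩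
  · rintro ⟨s, hrs, hs⟩
    refine lt_of_le_of_lt (csSup_le (nonempty_regularSup f x) fun t ht => ?_) hrs
    by_contra! hst
    refine hs (closure_mono ?_ ht)
    rintro y ⟨n, hn⟩
    exact ⟨n, hst.trans hn⟩

/-- Preimages of upper rays are unions of the closures, open by basic disconnectedness; preimages of
lower rays are unions of complements of closures, open in any space. -/
theorem BasicallyDisconnected.continuous_regularSup (hX : BasicallyDisconnected X)
    (f : ℕ → C(X, I)) : Continuous (regularSup f) := by
  refine OrderTopology.continuous_iff.2 fun r => ⟨?_, ?_⟩
  · have : regularSup f ⁻¹' Ioi r = ⋃ s ∈ Ioi r, closure {y | ∃ n, s < f n y} := by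
      ext x
      simp only [mem_preimage, mem_Ioi, lt_regularSup_iff, mem_iUnion, exists_prop]
    rw [this]
    exact isOpen_biUnion fun s _ => hX.isOpen_closure_iUnion f s
  · have : regularSup f ⁻¹' Iio r = ⋃ s ∈ Iio r, (closure {y | ∃ n, s < f n y})ᶜ := by
      ext x
      simp only [mem_preimage, mem_Iio, regularSup_lt_iff, mem_iUnion, exists_prop, mem_compl_iff]
    rw [this]
    exact isOpen_biUnion fun s _ => isClosed_closure.isOpen_compl

variable {E : Type u} {Φ : E → C(X, I)}

theorem exists_coe_eq_of_surjective (hsurj : Function.Surjective Φ) {f : X → ℝ} (hf : Continuous f)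
    (hI : ∀ x, f x ∈ I) : ∃ a, ∀ x, (Φ a x : ℝ) = f x := by
  obtain ⟨a, ha⟩ := hsurj ⟨fun x => ⟨f x, hI x⟩, hf.subtype_mk hI⟩
  exact ⟨a, fun x => by rw [ha]; rfl⟩

theorem exists_separating_of_surjective [CompactSpace X] [T2Space X] (hsurj : Function.Surjective Φ) {K : Set X}
    (hK : IsClosed K) {x : X} (hx : x ∉ K) :
    ∃ a, (Φ a x : ℝ) = 0 ∧ ∀ y ∈ K, (Φ a y : ℝ) = 1 := by
  obtain ⟨g, h0, h1, hg⟩ := exists_continuous_zero_one_of_isClosed (isClosed_singleton (x := x)) hK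
    (disjoint_singleton_left.2 hx)
  obtain ⟨a, ha⟩ := exists_coe_eq_of_surjective hsurj g.continuous hg
  exact ⟨a, by rw [ha]; exact h0 rfl, fun y hy => by rw [ha]; exact h1 hy⟩

variable [EffectAlgebra E] [SequentialProduct E] [ConvexStructure E]

namespace IsConvexSEAMono

/-- The supremum is `regularSup`: a continuous upper bound that is at least `r` wherever some `f n`
exceeds `r` is still at least `r` on the closure. -/
theorem monotoneSigmaComplete (h : IsConvexSEAMono Φ) (hsurj : Function.Surjective Φ)
    (hX : BasicallyDisconnected X) : MonotoneSigmaComplete E := by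
  intro f _
  obtain ⟨s, hs⟩ := exists_coe_eq_of_surjective hsurj (hX.continuous_regularSup fun n => Φ (f n))
    (regularSup_mem fun n => Φ (f n))
  refine ⟨s, fun n => h.le_iff_forall_le.2 fun x => ?_, fun t ht => h.le_iff_forall_le.2 fun x => ?_⟩
  · rw [hs]
    refine le_of_forall_lt fun r hr => ?_
    obtain ⟨q, hrq, hq⟩ := exists_between hr
    exact lt_regularSup_iff.2 ⟨q, hrq, subset_closure ⟨n, hq⟩⟩
  · rw [hs]
    refine csSup_le (nonempty_regularSup _ x) fun r hr => ?_
    have hcl : IsClosed {y | r ≤ (Φ t y : ℝ)} := isClosed_le continuous_const (by fun_prop)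
    refine closure_minimal ?_ hcl hr
    rintro y ⟨n, hn⟩
    exact hn.le.trans (h.le_iff_forall_le.1 (ht n) y)

/-- Suprema in `E` need not be pointwise, but here they are. Put `g = 1 / 4 + f / 2` and choose `a
n` within `ε n / 4` of `g - ε n`. As `ε` shrinks by a factor `4`, the sequence ascends, and `a n + 2
ε n` is an upper bound lying in `E`, so the supremum is within `2 ε n` of `g` for all `n`. -/
theorem surjective_of_monotoneSigmaComplete (h : IsConvexSEAMono Φ)
    (hdense : ∀ (f : C(X, I)) (ε : ℝ), 0 < ε → ∃ a, ∀ x, |(Φ a x : ℝ) - f x| < ε)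
    (hE : MonotoneSigmaComplete E) : Function.Surjective Φ := by
  intro f
  -- Starting at `1 / 16` keeps `g - ε n` and `a n + 2 ε n` inside `[0, 1]`, since `g` has values in
  -- `[1 / 4, 3 / 4]`.
  let ε : ℕ → ℝ := fun n => (1 / 4) ^ (n + 2)
  have hε : ∀ n, 0 < ε n := fun n => by positivity
  have hε1 : ∀ n, ε n ≤ 1 / 16 := fun n => by
    have : ε n = (1 / 4) ^ n * (1 / 16) := by simp only [ε, pow_add]; norm_num
    rw [this]
    have := pow_le_one₀ (n := n) (show (0 : ℝ) ≤ 1 / 4 by norm_num) (by norm_num)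
    linarith
  have hε2 : ∀ n, ε (n + 1) = ε n / 4 := fun n => by simp only [ε, pow_succ]; ring
  have key : ∀ n, ∃ a, ∀ x, |(Φ a x : ℝ) - (1 / 4 + (f x : ℝ) / 2 - ε n)| < ε n / 4 := by
    intro n
    have hI : ∀ x, 1 / 4 + (f x : ℝ) / 2 - ε n ∈ I := fun x => by
      constructor <;> linarith [(f x).2.1, (f x).2.2, hε n, hε1 n]
    exact hdense ⟨fun x => ⟨_, hI x⟩, by fun_prop⟩ _ (by linarith [hε n])
  choose a ha using key
  have lo : ∀ n x, 1 / 4 + (f x : ℝ) / 2 - 5 / 4 * ε n ≤ Φ (a n) x := fun n x => by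
    linarith [(abs_lt.1 (ha n x)).1]
  have hi : ∀ n x, (Φ (a n) x : ℝ) ≤ 1 / 4 + (f x : ℝ) / 2 - 3 / 4 * ε n := fun n x => by
    linarith [(abs_lt.1 (ha n x)).2]
  obtain ⟨s, hs, hs'⟩ := hE a fun n => h.le_iff_forall_le.2 fun x => by
    linarith [hi n x, lo (n + 1) x, hε2 n, hε n]
  have hbound : ∀ n x, |(Φ s x : ℝ) - (1 / 4 + (f x : ℝ) / 2)| ≤ 2 * ε n := by
    intro n x
    obtain ⟨c, hc⟩ := h.exists_const (r := 2 * ε n) (by linarith [hε n]) (by linarith [hε1 n])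
    obtain ⟨t, ht⟩ := h.exists_add (a := a n) (b := c) fun x => by
      rw [hc]
      linarith [hi n x, hε n, hε1 n, (f x).2.2]
    have h1 := h.le_iff_forall_le.1 (hs n) x
    have h2 := h.le_iff_forall_le.1 (hs' t fun m => h.le_iff_forall_le.2 fun x => by
      rw [ht, hc]
      linarith [hi m x, lo n x, hε m, hε n]) x
    rw [ht, hc] at h2
    rw [abs_le]
    constructor <;> linarith [lo n x, hi n x, hε n]
  have hlim : Filter.Tendsto (fun n => 2 * ε n) Filter.atTop (nhds (2 * 0)) :=
    ((tendsto_pow_atTop_nhds_zero_of_lt_one (by norm_num) (by norm_num)).comp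
      (Filter.tendsto_add_atTop_nat 2)).const_mul 2
  rw [mul_zero] at hlim
  have hsx : ∀ x, (Φ s x : ℝ) = 1 / 4 + (f x : ℝ) / 2 := fun x =>
    sub_eq_zero.1 (abs_eq_zero.1 ((ge_of_tendsto' hlim fun n => hbound n x).antisymm (abs_nonneg _)))
  obtain ⟨c, hc⟩ := h.exists_const (r := 1 / 4) (by norm_num) (by norm_num)
  obtain ⟨d, hd⟩ := h.exists_sub (a := c) (b := s) fun x => by
    rw [hc, hsx]; linarith [(f x).2.1]
  obtain ⟨e, he⟩ := h.exists_div (t := 1 / 2) (by norm_num) (a := d) fun x => by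
    rw [hd, hsx, hc]; linarith [(f x).2.2]
  refine ⟨e, ContinuousMap.ext fun x => Subtype.ext ?_⟩
  have := he x
  rw [hd, hsx, hc] at this
  linarith

/-- The supremum `s` of the functions `min (n |f|) 1` is `1` on the closure of the cozero set. It
vanishes at any point outside, since a Urysohn function that is `1` on the closure and `0` at the
point is an upper bound. -/
theorem basicallyDisconnected [CompactSpace X] [T2Space X] (h : IsConvexSEAMono Φ)
    (hsurj : Function.Surjective Φ) (hE : MonotoneSigmaComplete E) : BasicallyDisconnected X := by
  intro f
  choose a ha using fun n : ℕ => exists_coe_eq_of_surjective hsurj (f := fun x => min (n * |f x|) 1)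
    (by fun_prop) fun x => ⟨by positivity, min_le_right _ _⟩
  obtain ⟨s, hs, hs'⟩ := hE a fun n => h.le_iff_forall_le.2 fun x => by
    rw [ha, ha]
    gcongr
    exact n.le_succ
  have hcl : closure {x | f x ≠ 0} ⊆ {x | (Φ s x : ℝ) = 1} := by
    refine closure_minimal (fun x hx => ?_) (isClosed_eq (by fun_prop) continuous_const)
    obtain ⟨n, hn⟩ := exists_nat_gt (1 / |f x|)
    rw [div_lt_iff₀ (abs_pos.2 hx)] at hn
    have h1 := h.le_iff_forall_le.1 (hs n) x
    rw [ha, min_eq_right hn.le] at h1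
    exact (Φ s x).2.2.antisymm h1
  have : closure {x | f x ≠ 0} = {x | 0 < (Φ s x : ℝ)} := by
    refine Subset.antisymm (fun x hx => by rw [mem_ofPred_eq, hcl hx]; exact one_pos) fun x hx => ?_
    by_contra hxU
    obtain ⟨t, ht0, ht1⟩ := exists_separating_of_surjective hsurj isClosed_closure hxU
    have h1 := h.le_iff_forall_le.1 (hs' t fun n => h.le_iff_forall_le.2 fun y => by
      by_cases hy : f y = 0
      · rw [ha, hy]
        simpa using (Φ t y).2.1
      · rw [ht1 y (subset_closure hy)]
        exact (Φ (a n) y).2.2) x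
    rw [ht0] at h1
    exact h1.not_gt hx
  rw [this]
  exact isOpen_lt continuous_const (by fun_prop)

end IsConvexSEAMono
end Disconnected

/-! ### Spectrality -/

section Spectral
variable {X : Type v} [TopologicalSpace X]
variable {E : Type u} [EffectAlgebra E] [SequentialProduct E]

theorem mem_commutant (hcomm : ∀ a b : E, a ∘ₑ b = b ∘ₑ a) (p a : E) : a ∈ (seqBase E).C p := by
  have h := SequentialProduct.seq_oplus a p pᗮₑ (perp_orth p)
  rw [oplus_orth, seq_one, hcomm a p, hcomm a] at h
  exact h

theorem biComm_eq (hcomm : ∀ a b : E, a ∘ₑ b = b ∘ₑ a) (Q : Set E) :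
    (seqBase E).biComm Q = {p | IsSharp p} :=
  Subset.antisymm (fun _ h => h.1) fun _ h => ⟨h, fun _ _ => mem_commutant hcomm _ _⟩

/-- In the commutative case all commutants are all of `E`, so this trivial Boolean algebra witnesses
the b-property for every element. -/
theorem isBooleanSubalgebra_zero_one : IsBooleanSubalgebra {p : E | IsSharp p} {0, 1} := by
  have m0 : (0 : E) ∈ ({0, 1} : Set E) := Or.inl rfl
  have m1 : (1 : E) ∈ ({0, 1} : Set E) := Or.inr rfl
  refine ⟨?_, ⟨m0, m1, ?_, ?_⟩, ?_, ?_, ?_, ?_, ?_⟩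
  · rintro _ (rfl | rfl)
    · exact (seqBase E).isSubEA.zero_mem
    · exact (seqBase E).isSubEA.one_mem
  · rintro _ (rfl | rfl)
    · rw [orth_zero]; exact m1
    · rw [orth_one]; exact m0
  · rintro _ (rfl | rfl) b hb h
    · rwa [(zero_perp b).2]
    · rw [eq_zero_of_perp_one b (comm _ _ h).1, (perp_zero 1).2]; exact m1
  · rintro _ (rfl | rfl) y hy
    · exact ⟨0, m0, le_refl _, zero_le _, fun _ _ hz _ => hz⟩
    · exact ⟨y, hy, le_one _, le_refl _, fun _ _ _ hz => hz⟩
  · rintro _ (rfl | rfl) y hy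
    · exact ⟨y, hy, zero_le _, le_refl _, fun _ _ _ hz => hz⟩
    · exact ⟨1, m1, le_refl _, le_one _, fun _ _ hz _ => hz⟩
  · rintro _ (rfl | rfl)
    · exact ⟨m0, zero_le _, zero_le _, fun _ _ hz _ => hz⟩
    · exact ⟨m0, zero_le _, zero_le _, fun _ _ _ hz => by rwa [orth_one] at hz⟩
  · rintro _ (rfl | rfl)
    · exact ⟨m1, le_one _, le_one _, fun _ _ _ hz => by rwa [orth_zero] at hz⟩
    · exact ⟨m1, le_one _, le_one _, fun _ _ hz _ => hz⟩
  · rintro _ (rfl | rfl) y hy z hz j m m₁ m₂ hj hm hm₁ hm₂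
    · rw [le_zero hm.2.1, le_zero hm₁.2.1, le_zero hm₂.2.1]
      exact ⟨m0, le_refl _, le_refl _, fun _ _ hz _ => hz⟩
    · have meet_one : ∀ {x n : E}, x ∈ ({0, 1} : Set E) → IsMeetIn {0, 1} 1 x n → n = x :=
        fun hx hn => le_antisymm hn.2.2.1 (hn.2.2.2 _ hx (le_one _) (le_refl _))
      rwa [meet_one hj.1 hm, meet_one hy hm₁, meet_one hz hm₂]

variable [ConvexStructure E] {Φ : E → C(X, I)}

namespace IsConvexSEAMono

/-- Sharp elements are the idempotents of the sequential product, and an idempotent function takes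
only the values `0` and `1`. -/
theorem isSharp_iff (h : IsConvexSEAMono Φ) {p : E} :
    IsSharp p ↔ ∀ x, (Φ p x : ℝ) = 0 ∨ (Φ p x : ℝ) = 1 := by
  have : IsSharp p ↔ p ∘ₑ p = p := ⟨fun hp => (seq_eq_self hp (le_refl p)).1, isSharp_of_idem⟩
  rw [this, ← h.injective.eq_iff]
  constructor
  · intro hp x
    have h1 := h.coe_seq p p x
    rw [hp] at h1
    have h2 : (Φ p x : ℝ) * (Φ p x - 1) = 0 := by linarith
    rcases mul_eq_zero.1 h2 with h2 | h2
    · exact Or.inl h2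
    · exact Or.inr (by linarith)
  · intro hp
    ext x
    rw [h.coe_seq]
    rcases hp x with h1 | h1 <;> rw [h1] <;> norm_num

theorem exists_isSharp (h : IsConvexSEAMono Φ) (hsurj : Function.Surjective Φ) {K : Set X}
    (hK : IsClopen K) :
    ∃ p, IsSharp p ∧ (∀ x ∈ K, (Φ p x : ℝ) = 1) ∧ ∀ x ∉ K, (Φ p x : ℝ) = 0 := by
  obtain ⟨p, hp⟩ := exists_coe_eq_of_surjective hsurj (f := K.indicator fun _ => (1 : ℝ))
    (continuous_const.indicator (by simp [hK.frontier_eq])) fun x => by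
      by_cases hx : x ∈ K <;> simp [hx]
  refine ⟨p, h.isSharp_iff.2 fun x => ?_, fun x hx => by simp [hp, hx], fun x hx => by simp [hp, hx]⟩
  by_cases hx : x ∈ K <;> simp [hp, hx]

/-- The indicator of the closure of `{a ≠ 0}` is the projection cover of `a`. For comparability, `p`
is the indicator of the complement of the closure of `{e > f}`: off the closure `e ≤ f`, and on it
`f ≤ e` by continuity. -/
theorem spectral (h : IsConvexSEAMono Φ) (hsurj : Function.Surjective Φ)
    (hcomm : ∀ a b : E, a ∘ₑ b = b ∘ₑ a) (hX : BasicallyDisconnected X) :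
    (seqBase E).Spectral := by
  refine ⟨fun a => ?_, fun a => ⟨{0, 1}, isBooleanSubalgebra_zero_one, fun p _ =>
    ⟨fun _ b _ => mem_commutant hcomm p b, fun _ => mem_commutant hcomm p a⟩⟩, fun e f _ => ?_⟩
  · have hK : IsClopen (closure {x | (Φ a x : ℝ) ≠ 0}) :=
      ⟨isClosed_closure, hX ⟨fun x => (Φ a x : ℝ), by fun_prop⟩⟩
    obtain ⟨p, hp, hp1, hp0⟩ := h.exists_isSharp hsurj hK
    refine ⟨p, hp, fun q hq => ?_⟩
    have hq' := h.isSharp_iff.1 hq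
    rw [h.le_iff_forall_le, h.le_iff_forall_le]
    constructor
    · intro haq x
      by_cases hx : x ∈ closure {x | (Φ a x : ℝ) ≠ 0}
      · have hcl : IsClosed {x | (Φ q x : ℝ) = 1} := isClosed_eq (by fun_prop) continuous_const
        have hsub : {x | (Φ a x : ℝ) ≠ 0} ⊆ {x | (Φ q x : ℝ) = 1} := fun y hy =>
          (hq' y).resolve_left fun h0 => hy (((haq y).trans h0.le).antisymm (Φ a y).2.1)
        have : (Φ q x : ℝ) = 1 := closure_minimal hsub hcl hx
        rw [this]
        exact (Φ p x).2.2
      · rw [hp0 x hx]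
        exact (Φ q x).2.1
    · intro hpq x
      refine (?_ : (Φ a x : ℝ) ≤ Φ p x).trans (hpq x)
      by_cases hx : x ∈ closure {x | (Φ a x : ℝ) ≠ 0}
      · rw [hp1 x hx]
        exact (Φ a x).2.2
      · by_contra! hlt
        exact hx (subset_closure ((Φ p x).2.1.trans_lt hlt).ne')
  · have hK : IsClopen (closure {x | max ((Φ e x : ℝ) - Φ f x) 0 ≠ 0}) :=
      ⟨isClosed_closure, hX ⟨fun x => max ((Φ e x : ℝ) - Φ f x) 0, by fun_prop⟩⟩
    obtain ⟨p, hp, hp1, hp0⟩ := h.exists_isSharp hsurj hK.compl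
    rw [biComm_eq hcomm]
    refine ⟨p, hp, h.le_iff_forall_le.2 fun x => ?_, h.le_iff_forall_le.2 fun x => ?_⟩
    · show (Φ (p ∘ₑ e) x : ℝ) ≤ Φ (p ∘ₑ f) x
      rw [h.coe_seq, h.coe_seq]
      by_cases hx : x ∈ closure {x | max ((Φ e x : ℝ) - Φ f x) 0 ≠ 0}
      · rw [hp0 x (fun hx' => hx' hx), zero_mul, zero_mul]
      · refine mul_le_mul_of_nonneg_left ?_ (Φ p x).2.1
        by_contra! hlt
        exact hx (subset_closure (lt_max_of_lt_left (sub_pos.2 hlt)).ne')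
    · show (Φ (pᗮₑ ∘ₑ f) x : ℝ) ≤ Φ (pᗮₑ ∘ₑ e) x
      rw [h.coe_seq, h.coe_seq, h.coe_orth]
      by_cases hx : x ∈ closure {x | max ((Φ e x : ℝ) - Φ f x) 0 ≠ 0}
      · rw [hp0 x (fun hx' => hx' hx)]
        have hcl : IsClosed {x | (Φ f x : ℝ) ≤ Φ e x} := isClosed_le (by fun_prop) (by fun_prop)
        have : (Φ f x : ℝ) ≤ Φ e x := closure_minimal (fun y hy => by
          by_contra hlt
          exact hy (max_eq_right (sub_nonpos.2 (not_le.1 hlt).le))) hcl hx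
        linarith
      · rw [hp1 x hx, sub_self, zero_mul, zero_mul]

/-- The common part is `p ∘ₑ q`, and the total is represented by `1 - (1 - p) (1 - q) ≤ 1`. Hence
comparability applies to every pair of elements. -/
theorem compatible_of_commutative (h : IsConvexSEAMono Φ) (hcomm : ∀ a b : E, a ∘ₑ b = b ∘ₑ a)
    (p q : E) : Compatible p q := by
  have hp := SequentialProduct.seq_oplus p qᗮₑ q (comm _ _ (perp_orth q)).1
  have hq := SequentialProduct.seq_oplus q pᗮₑ p (comm _ _ (perp_orth p)).1
  rw [← (comm _ _ (perp_orth _)).2, oplus_orth, seq_one] at hp hq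
  have h1 : (p ∘ₑ qᗮₑ) ⟂ₑ (q ∘ₑ pᗮₑ) := h.perp_iff_forall.2 fun x => by
    rw [h.coe_seq, h.coe_seq, h.coe_orth, h.coe_orth]
    nlinarith [(Φ p x).2.1, (Φ p x).2.2, (Φ q x).2.1, (Φ q x).2.2]
  refine ⟨_, _, _, h1, h.perp_iff_forall.2 fun x => ?_, hp.2, by rw [hcomm p q]; exact hq.2⟩
  rw [h.coe_oplus h1, h.coe_seq, h.coe_seq, h.coe_seq, h.coe_orth, h.coe_orth]
  nlinarith [mul_nonneg (sub_nonneg.2 (Φ p x).2.2) (sub_nonneg.2 (Φ q x).2.2)]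

/-- The closure of the cozero set of `f` is `{c > 0}`, with `c` the projection cover of `a = min |f|
1`. To exclude a point `x` outside the closure, take a Urysohn function `g` with `g x = 0` and `g =
1` on the closure. Comparing `g` with the constant `1 / 2` gives a sharp `p` that is `1` wherever `g
> 1 / 2` and `0` wherever `g < 1 / 2`. So `a ≼ p`, whence `c ≼ p`, and `c` vanishes at `x`. -/
theorem basicallyDisconnected_of_spectral [CompactSpace X] [T2Space X] (h : IsConvexSEAMono Φ)
    (hsurj : Function.Surjective Φ) (hcomm : ∀ a b : E, a ∘ₑ b = b ∘ₑ a)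
    (hE : (seqBase E).Spectral) : BasicallyDisconnected X := by
  intro f
  obtain ⟨a, ha⟩ := exists_coe_eq_of_surjective hsurj (f := fun x => min |f x| 1) (by fun_prop)
    fun x => ⟨by positivity, min_le_right _ _⟩
  have ha0 : ∀ x, f x ≠ 0 → 0 < (Φ a x : ℝ) := fun x hx => by
    rw [ha]; exact lt_min (abs_pos.2 hx) one_pos
  obtain ⟨c, hc, hca⟩ := hE.1 a
  have hc' := h.isSharp_iff.1 hc
  have hac := h.le_iff_forall_le.1 ((hca c hc).2 (le_refl c))
  have : closure {x | f x ≠ 0} = {x | 0 < (Φ c x : ℝ)} := by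
    apply Subset.antisymm
    · have hcl : IsClosed {x | (Φ c x : ℝ) = 1} := isClosed_eq (by fun_prop) continuous_const
      refine fun x hx => lt_of_lt_of_eq one_pos (Eq.symm (closure_minimal (fun y hy => ?_) hcl hx))
      exact (hc' y).resolve_left ((ha0 y hy).trans_le (hac y)).ne'
    · intro x hx
      by_contra hxU
      obtain ⟨g, hg0, hg1⟩ := exists_separating_of_surjective hsurj isClosed_closure hxU
      obtain ⟨m, hm⟩ := h.exists_const (r := 1 / 2) (by norm_num) (by norm_num)
      obtain ⟨p, hp, hp1, hp2⟩ := hE.2.2 m g fun p _ q _ =>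
        h.compatible_of_commutative hcomm p q
      rw [biComm_eq hcomm] at hp
      have hp' := h.isSharp_iff.1 hp
      have hp1 : ∀ y, (Φ p y : ℝ) * (1 / 2) ≤ Φ p y * Φ g y := fun y => by
        have := h.le_iff_forall_le.1 hp1 y
        change (Φ (p ∘ₑ m) y : ℝ) ≤ Φ (p ∘ₑ g) y at this
        rwa [h.coe_seq, h.coe_seq, hm] at this
      have hp2 : ∀ y, (1 - (Φ p y : ℝ)) * Φ g y ≤ (1 - (Φ p y : ℝ)) * (1 / 2) := fun y => by
        have := h.le_iff_forall_le.1 hp2 y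
        change (Φ (pᗮₑ ∘ₑ g) y : ℝ) ≤ Φ (pᗮₑ ∘ₑ m) y at this
        rwa [h.coe_seq, h.coe_seq, h.coe_orth, hm] at this
      have hap : a ≼ p := h.le_iff_forall_le.2 fun y => by
        by_cases hy : f y = 0
        · rw [ha, hy]
          simpa using (Φ p y).2.1
        · have h1 := hp2 y
          rw [hg1 y (subset_closure hy)] at h1
          rcases hp' y with h2 | h2
          · rw [h2] at h1; norm_num at h1
          · rw [h2]; exact (Φ a y).2.2
      have h3 := h.le_iff_forall_le.1 ((hca p hp).1 hap) x
      have h4 := hp1 x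
      rw [hg0] at h4
      exact (hx.trans_le h3).not_ge (by linarith)
  rw [this]
  exact isOpen_lt continuous_const (by fun_prop)

end IsConvexSEAMono
end Spectral
end EffectAlgebra

theorem mainTheorem7 {E : Type u} [EffectAlgebra E] [EffectAlgebra.SequentialProduct E]
    [EffectAlgebra.ConvexStructure E]
    (hcomm : ∀ a b : E, a ∘ₑ b = b ∘ₑ a) (harch : EffectAlgebra.StronglyArchimedean E) :
    (∃ (X : Type u) (_ : TopologicalSpace X) (_ : CompactSpace X) (_ : T2Space X)
      (Φ : E → C(X, I)), EffectAlgebra.IsConvexSEAMono Φ ∧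
        EffectAlgebra.IsConvexSubSEA (Set.range Φ) ∧ DenseRange Φ) ∧
    List.TFAE [
      EffectAlgebra.MonotoneSigmaComplete E,
      ∃ (X : Type u) (_ : TopologicalSpace X) (_ : CompactSpace X) (_ : T2Space X)
        (Φ : E → C(X, I)), EffectAlgebra.BasicallyDisconnected X ∧ EffectAlgebra.IsConvexSEAIso Φ,
      EffectAlgebra.NormComplete E ∧ (EffectAlgebra.seqBase E).Spectral] := by
  have h := EffectAlgebra.isConvexSEAMono_gelfand hcomm harch
  have hdense : ∀ (f : C(EffectAlgebra.Spectrum E, I)) (ε : ℝ), 0 < ε →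
      ∃ a, ∀ x, |(EffectAlgebra.gelfand a x : ℝ) - f x| < ε := by
    refine fun f ε hε => h.exists_near (fun φ ψ hne => ?_) f hε
    by_contra! heq
    exact hne (Subtype.ext (funext heq))
  refine ⟨⟨EffectAlgebra.Spectrum E, inferInstance, inferInstance, inferInstance,
    EffectAlgebra.gelfand, h, h.isConvexSubSEA_range, Metric.denseRange_iff.2 fun f ε hε => ?_⟩, ?_⟩
  · obtain ⟨a, ha⟩ := hdense f ε hε
    refine ⟨a, ?_⟩
    rw [dist_comm, ContinuousMap.dist_lt_iff hε]
    exact ha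
  tfae_have 1 → 2 := fun hE => by
    have hsurj := h.surjective_of_monotoneSigmaComplete hdense hE
    exact ⟨_, _, inferInstance, inferInstance, _, h.basicallyDisconnected hsurj hE, ⟨h, hsurj⟩⟩
  tfae_have 2 → 1 := by
    rintro ⟨X, _, _, _, Φ, hX, hΦ⟩
    exact hΦ.toIsConvexSEAMono.monotoneSigmaComplete hΦ.surjective hX
  tfae_have 2 → 3 := by
    rintro ⟨X, _, _, _, Φ, hX, hΦ⟩
    exact ⟨hΦ.toIsConvexSEAMono.normComplete_of_surjective hΦ.surjective,
      hΦ.toIsConvexSEAMono.spectral hΦ.surjective hcomm hX⟩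
  tfae_have 3 → 2 := by
    rintro ⟨hE, hS⟩
    have hsurj := h.surjective_of_normComplete hdense hE
    exact ⟨_, _, inferInstance, inferInstance, _,
      h.basicallyDisconnected_of_spectral hsurj hcomm hS, ⟨h, hsurj⟩⟩
  tfae_finish
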